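/- An instance $\varphi$ of $(3,4)$-SAT with $n$ variables $x_0,\dots,x_{n-1}$ is a CNF formula in which every clause consists of three literals over three different variables and every variable occurs in at most four clauses. An instance $(G,L)$ of List Edge Coloring in Simple Graphs is a finite simple graph $G$ together with a finite list $L(e)\subset\mathbb{N}$ for every edge $e$; a list edge coloring of $(G,L)$ is a function $c\colon E(G)\to\mathbb{N}$ with $c(e)\in L(e)$ for every edge $e$ and $c(e)\neq c(f)$ for any two distinct edges $e,f$ that share an endpoint. There is a polynomial-time algorithm that transforms every $(3,4)$-SAT instance $\varphi$ with $n$ variables into an instance $(G,L)$ of List Edge Coloring in Simple Graphs such that 1. $\varphi$ is satisfiable if and only if $(G,L)$ has a list edge coloring; 2. $|V(G)| = O(\sqrt{n})$, that is, there is an absolute constant $K$ with $|V(G)|\le K\sqrt n$ for all $\varphi$ with $n\ge 1$ variables; 3. $V(G)$ is partitioned into $63$ layers $L_0,\dots,L_{62}$ such that no edge joins two vertices of the same layer, and, when the colors $2i$ and $2i+1$ are denoted by $x_i$ and $\neg x_i$ respectively, for every list edge coloring $c$ of $(G,L)$ and every $i\in\{0,\dots,n-1\}$ the edges $e$ with $c(e)\in\{x_i,\neg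 x_i\}$ are exactly the edges of a path from $L_0$ to $L_{62}$ that has exactly one vertex in each layer and on which the colors $x_i$ and $\neg x_i$ alternate. Here the running time is the number of steps of a random access machine with unit-cost addition and subtraction, and it is bounded by a polynomial in $n$. -/

import Mathlib

/-! ### (3,4)-SAT -/

/-- An instance of (3,4)-SAT with variables `x_0, …, x_{numVars-1}`. A literal is a variable together
with a sign (`true` for `x_i`, `false` for `¬ x_i`). Every clause consists of three literals over
three different variables, and every variable occurs in at most four clauses. -/
structure ThreeFourSAT where
  numVars : ℕ
  clauses : List (Fin 3 → Fin numVars × Bool)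
  three_variables : ∀ C ∈ clauses, Function.Injective fun j => (C j).1
  at_most_four : ∀ x : Fin numVars,
    clauses.countP (fun C => decide (∃ j, (C j).1 = x)) ≤ 4

namespace ThreeFourSAT

/-- Some truth assignment makes at least one literal of every clause true. -/
def Satisfiable (φ : ThreeFourSAT) : Prop :=
  ∃ f : Fin φ.numVars → Bool, ∀ C ∈ φ.clauses, ∃ j, f (C j).1 = (C j).2

/-- The number that stands for a literal: `2 i` for `x_i` and `2 i + 1` for `¬ x_i`. -/
def literalCode {n : ℕ} (l : Fin n × Bool) : ℕ :=
  2 * (l.1 : ℕ) + if l.2 then 0 else 1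

/-- The formula written as a sequence of numbers: the number of variables, the number of clauses,
and then the three literals of each clause. -/
def word (φ : ThreeFourSAT) : List ℕ :=
  φ.numVars :: φ.clauses.length ::
    φ.clauses.flatMap fun C => List.ofFn fun j => literalCode (C j)

end ThreeFourSAT

/-! ### List Edge Coloring in simple graphs -/

/-- An instance of List Edge Coloring in Simple Graphs: a finite simple graph with a finite list of
allowed colors (natural numbers) for each edge. -/
structure ListEdgeColoringInstance where
  numVertices : ℕ
  graph : SimpleGraph (Fin numVertices)
  list : graph.edgeSet → Finset ℕ

namespace ListEdgeColoringInstance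

/-- `c` takes the color of each edge from its list and gives different colors to different edges
that share an endpoint. -/
def IsColoring (I : ListEdgeColoringInstance) (c : I.graph.edgeSet → ℕ) : Prop :=
  (∀ e, c e ∈ I.list e) ∧
    ∀ e f : I.graph.edgeSet, e ≠ f →
      (∃ v, v ∈ (e : Sym2 (Fin I.numVertices)) ∧ v ∈ (f : Sym2 (Fin I.numVertices))) → c e ≠ c f

/-- The instance is a YES-instance. -/
def Colorable (I : ListEdgeColoringInstance) : Prop :=
  ∃ c, I.IsColoring c

/-- The sequence of numbers `w` is a description of the instance `I`: the number of vertices,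
followed by a list of all edges without repetitions, where each edge is written as its two
endpoints, the length of its list, and the colors on its list without repetitions. -/
def IsDescribedBy (I : ListEdgeColoringInstance) (w : List ℕ) : Prop :=
  ∃ entries : List (Fin I.numVertices × Fin I.numVertices × List ℕ),
    w = I.numVertices ::
      entries.flatMap (fun t => (t.1 : ℕ) :: (t.2.1 : ℕ) :: t.2.2.length :: t.2.2) ∧
    (entries.map fun t => s(t.1, t.2.1)).Nodup ∧
    (∀ e, e ∈ I.graph.edgeSet ↔ ∃ t ∈ entries, s(t.1, t.2.1) = e) ∧
    ∀ t ∈ entries, t.2.2.Nodup ∧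
      ∀ h : s(t.1, t.2.1) ∈ I.graph.edgeSet, I.list ⟨s(t.1, t.2.1), h⟩ = t.2.2.toFinset

/-- In every list edge coloring, the edges colored `x_i` or `¬ x_i` are exactly the edges of a path
that starts in the first of the 63 layers, ends in the last one, has exactly one vertex in each
layer, and on which the two colors alternate. -/
def HasAlternatingPath (I : ListEdgeColoringInstance) (layer : Fin I.numVertices → Fin 63)
    {n : ℕ} (i : Fin n) : Prop :=
  ∀ c, I.IsColoring c →
    ∃ (u v : Fin I.numVertices) (P : I.graph.Walk u v),
      P.IsPath ∧ layer u = 0 ∧ layer v = 62 ∧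
      (∀ k : Fin 63, ∃! y, y ∈ P.support ∧ layer y = k) ∧
      (∀ e : I.graph.edgeSet, (e : Sym2 (Fin I.numVertices)) ∈ P.edges ↔
        c e = ThreeFourSAT.literalCode (i, true) ∨ c e = ThreeFourSAT.literalCode (i, false)) ∧
      ∀ (k : ℕ) (h : k + 1 < P.edges.length),
        c ⟨P.edges[k], P.edges_subset_edgeSet (List.getElem_mem _)⟩ ≠
          c ⟨P.edges[k + 1], P.edges_subset_edgeSet (List.getElem_mem h)⟩

end ListEdgeColoringInstance

/-! ### Random access machines

A program works on registers and arrays, all holding natural numbers, and appends its results to an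
output sequence. The only arithmetic operations are addition and truncated subtraction, each of
unit cost. Hence each step increases the bit length of the numbers by at most a constant that
depends on the program, and this model is polynomially equivalent to Turing machines. -/

namespace RAM

structure State where
  reg : ℕ → ℕ
  arr : ℕ → ℕ → ℕ
  out : List ℕ

/-- `read a e` is the entry of array number `a` at the index given by `e`. -/
inductive Term where
  | const (k : ℕ)
  | reg (x : ℕ)
  | read (a : ℕ) (e : Term)
  | add (e f : Term)
  | sub (e f : Term)

namespace Term

def eval (s : State) : Term → ℕ
  | const k => k
  | reg x => s.reg x
  | read a e => s.arr a (e.eval s)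
  | add e f => e.eval s + f.eval s
  | sub e f => e.eval s - f.eval s

/-- The number of elementary operations in the evaluation. -/
def cost : Term → ℕ
  | const _ => 1
  | reg _ => 1
  | read _ e => e.cost + 1
  | add e f => e.cost + f.cost + 1
  | sub e f => e.cost + f.cost + 1

end Term

inductive Prog where
  | skip
  | assign (x : ℕ) (e : Term)
  | store (a : ℕ) (e f : Term)
  | emit (e : Term)
  | seq (p q : Prog)
  | ite (e : Term) (p q : Prog)
  | loop (e : Term) (p : Prog)

/-- `Exec p s s' t`: started in state `s`, the program `p` halts in state `s'` after `t` steps.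
A condition counts as true if its value is not zero. -/
inductive Exec : Prog → State → State → ℕ → Prop
  | skip (s : State) : Exec .skip s s 1
  | assign (x : ℕ) (e : Term) (s : State) :
      Exec (.assign x e) s ⟨Function.update s.reg x (e.eval s), s.arr, s.out⟩ (e.cost + 1)
  | store (a : ℕ) (e f : Term) (s : State) :
      Exec (.store a e f) s
        ⟨s.reg, Function.update s.arr a (Function.update (s.arr a) (e.eval s) (f.eval s)), s.out⟩
        (e.cost + f.cost + 1)
  | emit (e : Term) (s : State) :
      Exec (.emit e) s ⟨s.reg, s.arr, s.out ++ [e.eval s]⟩ (e.cost + 1)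
  | seq {p q : Prog} {s s' s'' : State} {t t' : ℕ} :
      Exec p s s' t → Exec q s' s'' t' → Exec (.seq p q) s s'' (t + t')
  | ite_true {e : Term} {p q : Prog} {s s' : State} {t : ℕ} :
      e.eval s ≠ 0 → Exec p s s' t → Exec (.ite e p q) s s' (e.cost + 1 + t)
  | ite_false {e : Term} {p q : Prog} {s s' : State} {t : ℕ} :
      e.eval s = 0 → Exec q s s' t → Exec (.ite e p q) s s' (e.cost + 1 + t)
  | loop_done {e : Term} {p : Prog} {s : State} :
      e.eval s = 0 → Exec (.loop e p) s s (e.cost + 1)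
  | loop_step {e : Term} {p : Prog} {s s' s'' : State} {t t' : ℕ} :
      e.eval s ≠ 0 → Exec p s s' t → Exec (.loop e p) s' s'' t' →
        Exec (.loop e p) s s'' (e.cost + 1 + t + t')

/-- At the start, array `0` holds the input word; all else is zero and the output is empty. -/
def start (w : List ℕ) : State where
  reg _ := 0
  arr a i := if a = 0 then w.getD i 0 else 0
  out := []

end RAM

/-- A single program transforms each formula `φ` into a description of the instance `f φ`, in time
polynomial in the number `n` of variables (a formula has at most `4 n / 3` clauses, so this is the
same as polynomial in the size of `φ`). -/
def ComputableInPolynomialTime (f : ThreeFourSAT → ListEdgeColoringInstance) : Prop :=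
  ∃ (p : RAM.Prog) (T : Polynomial ℕ), ∀ φ : ThreeFourSAT, ∃ (s : RAM.State) (t : ℕ),
    RAM.Exec p (RAM.start φ.word) s t ∧ t ≤ T.eval φ.numVars ∧ (f φ).IsDescribedBy s.out


/-!
The gadget of a variable is a chain of twenty diamonds through the 63 layers. Every edge of it has
two allowed colors and the choice at one edge forces the choice at the next, so it has exactly two
colorings, one per truth value, and in both of them the colors `xᵢ` and `¬xᵢ` run along a path
through all layers. Each of the twelve layers `3 d` with `d < 12` is the port for one position of a
literal in its clause and one occurrence of its variable: one of two extra colors is used there,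
depending on the truth value. A clause is a vertex joined to the ports of its three literals. The
list of each of these edges holds the extra color that is free at the port if and only if the
literal is true, and two colors that belong to the clause. Two colors do not suffice for three edges
at one vertex, so the clause is colorable if and only if some literal is true.

To get by with `O(√n)` vertices, let `s` be about `√n` and write `i = a s + b`. The gadget of `xᵢ`
uses the vertex of index `a`, `b` or `a + b` in a layer, depending on the layer modulo 3. Two of
these numbers determine `i`, and edges join layers that differ modulo 3, so gadgets share vertices
but neither edges nor colors. Clause vertices are shared greedily between clauses without a common
port: a port serves at most `s` clauses, so `3 s + 1` indices suffice. The machine cannot multiply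
or divide and replaces both by running counters and tables.
-/

/-! ### Instances given by labelled edges -/

/-- A presentation of an instance of List Edge Coloring with edges indexed by labels: the vertices
are numbers below `numVertices`, and the edge with label `l` joins `left l` to `right l`. A machine
outputs an instance in this form. -/
structure LabelledInstance (Λ : Type*) where
  numVertices : ℕ
  labels : List Λ
  left : Λ → ℕ
  right : Λ → ℕ
  colors : Λ → List ℕ

namespace LabelledInstance

variable {Λ : Type*}

/-- The pair of endpoints of the edge with a given label. -/
def ends (D : LabelledInstance Λ) (l : Λ) : Sym2 ℕ :=
  s(D.left l, D.right l)

/-- The presented graph is simple, and nothing is listed twice. -/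
structure IsSimple (D : LabelledInstance Λ) : Prop where
  left_lt : ∀ l ∈ D.labels, D.left l < D.numVertices
  right_lt : ∀ l ∈ D.labels, D.right l < D.numVertices
  left_ne_right : ∀ l ∈ D.labels, D.left l ≠ D.right l
  nodup_colors : ∀ l ∈ D.labels, (D.colors l).Nodup
  nodup_labels : D.labels.Nodup
  ends_injOn : ∀ l ∈ D.labels, ∀ l' ∈ D.labels, D.ends l = D.ends l' → l = l'

/-- The presented instance of List Edge Coloring. -/
def toInstance (D : LabelledInstance Λ) : ListEdgeColoringInstance where
  numVertices := D.numVertices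
  graph := SimpleGraph.fromRel fun u v => ∃ l ∈ D.labels, D.left l = u ∧ D.right l = v
  list e := ((D.labels.filter fun l => D.ends l = e.1.map Fin.val).flatMap D.colors).toFinset

/-- The part of the output that describes the edge with a given label. -/
def entry (D : LabelledInstance Λ) (l : Λ) : List ℕ :=
  D.left l :: D.right l :: (D.colors l).length :: D.colors l

/-- The output that describes the presented instance. -/
def encoding (D : LabelledInstance Λ) : List ℕ :=
  D.numVertices :: D.labels.flatMap D.entry

/-- A list edge coloring of the presented instance, as a function of the labels. -/
def IsColoring (D : LabelledInstance Λ) (col : Λ → ℕ) : Prop :=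
  (∀ l ∈ D.labels, col l ∈ D.colors l) ∧
    ∀ l ∈ D.labels, ∀ l' ∈ D.labels, l ≠ l' → (∃ v, v ∈ D.ends l ∧ v ∈ D.ends l') → col l ≠ col l'

variable {D : LabelledInstance Λ}

namespace IsSimple

theorem mem_edgeSet_iff (hD : D.IsSimple) (e : Sym2 (Fin D.toInstance.numVertices)) :
    e ∈ D.toInstance.graph.edgeSet ↔ ∃ l ∈ D.labels, e.map Fin.val = D.ends l := by
  induction e with
  | _ u v =>
    simp only [toInstance, ends, Sym2.map_mk, Sym2.eq_iff]
    constructor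
    · rintro ⟨-, ⟨l, hl, hu, hv⟩ | ⟨l, hl, hv, hu⟩⟩
      · exact ⟨l, hl, Or.inl ⟨hu.symm, hv.symm⟩⟩
      · exact ⟨l, hl, Or.inr ⟨hu.symm, hv.symm⟩⟩
    · rintro ⟨l, hl, h⟩
      have hne := hD.left_ne_right l hl
      refine ⟨?_, h.imp (fun h => ⟨l, hl, h.1.symm, h.2.symm⟩) fun h => ⟨l, hl, h.2.symm, h.1.symm⟩⟩
      rintro (rfl : u = v)
      omega

theorem exists_edge (hD : D.IsSimple) {l : Λ} (hl : l ∈ D.labels) :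
    ∃ e : D.toInstance.graph.edgeSet, e.1.map Fin.val = D.ends l :=
  ⟨⟨s(⟨D.left l, hD.left_lt l hl⟩, ⟨D.right l, hD.right_lt l hl⟩),
    (hD.mem_edgeSet_iff _).2 ⟨l, hl, rfl⟩⟩, rfl⟩

theorem list_eq (hD : D.IsSimple) (e : D.toInstance.graph.edgeSet) {l : Λ} (hl : l ∈ D.labels)
    (he : e.1.map Fin.val = D.ends l) : D.toInstance.list e = (D.colors l).toFinset := by
  ext x
  simp only [toInstance, List.mem_toFinset, List.mem_flatMap, List.mem_filter, decide_eq_true_eq]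
  constructor
  · rintro ⟨l', ⟨hl', he'⟩, hx⟩
    rwa [hD.ends_injOn l hl l' hl' (he.symm.trans he'.symm)]
  · exact fun hx => ⟨l, ⟨hl, he.symm⟩, hx⟩

theorem isDescribedBy_encoding (hD : D.IsSimple) : D.toInstance.IsDescribedBy D.encoding := by
  refine ⟨D.labels.pmap
    (fun l (h : D.left l < D.numVertices ∧ D.right l < D.numVertices) =>
      (⟨D.left l, h.1⟩, ⟨D.right l, h.2⟩, D.colors l))
    fun l hl => ⟨hD.left_lt l hl, hD.right_lt l hl⟩, ?_, ?_, fun e => ?_, fun t ht => ?_⟩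
  · simp only [encoding, List.flatMap, List.map_pmap, List.pmap_eq_map]
    rfl
  · refine List.Nodup.of_map (Sym2.map Fin.val) ?_
    simp only [List.map_pmap, Sym2.map_mk, List.pmap_eq_map]
    exact hD.nodup_labels.map_on hD.ends_injOn
  · refine (hD.mem_edgeSet_iff e).trans ?_
    simp only [List.mem_pmap]
    constructor
    · rintro ⟨l, hl, h⟩
      exact ⟨_, ⟨l, hl, rfl⟩, Sym2.map.injective Fin.val_injective h.symm⟩
    · rintro ⟨_, ⟨l, hl, rfl⟩, rfl⟩
      exact ⟨l, hl, rfl⟩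
  · obtain ⟨l, hl, rfl⟩ := List.mem_pmap.1 ht
    exact ⟨hD.nodup_colors l hl, fun h => hD.list_eq _ hl rfl⟩

theorem colorable (hD : D.IsSimple) {col : Λ → ℕ} (hcol : D.IsColoring col) :
    D.toInstance.Colorable := by
  choose! label hlabel hends using fun e : D.toInstance.graph.edgeSet =>
    (hD.mem_edgeSet_iff e.1).1 e.2
  refine ⟨fun e => col (label e), fun e => ?_, ?_⟩
  · rw [hD.list_eq e (hlabel e) (hends e), List.mem_toFinset]
    exact hcol.1 _ (hlabel e)
  · rintro e f hef ⟨v, hve, hvf⟩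
    refine hcol.2 _ (hlabel e) _ (hlabel f) (fun h => hef ?_) ⟨v, ?_, ?_⟩
    · exact Subtype.ext (Sym2.map.injective Fin.val_injective
        ((hends e).trans ((congrArg D.ends h).trans (hends f).symm)))
    · exact hends e ▸ Sym2.mem_map.2 ⟨v, hve, rfl⟩
    · exact hends f ▸ Sym2.mem_map.2 ⟨v, hvf, rfl⟩

theorem exists_isColoring (hD : D.IsSimple) {c : D.toInstance.graph.edgeSet → ℕ}
    (hc : D.toInstance.IsColoring c) :
    ∃ col, D.IsColoring col ∧ ∀ e, ∀ l ∈ D.labels, e.1.map Fin.val = D.ends l → c e = col l := by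
  have hedge (l : Λ) : ∃ n, ∀ e : D.toInstance.graph.edgeSet,
      l ∈ D.labels → e.1.map Fin.val = D.ends l → c e = n := by
    by_cases h : ∃ e : D.toInstance.graph.edgeSet, e.1.map Fin.val = D.ends l
    · obtain ⟨e, he⟩ := h
      exact ⟨c e, fun e' _ he' =>
        congrArg c (Subtype.ext (Sym2.map.injective Fin.val_injective (he'.trans he.symm)))⟩
    · exact ⟨0, fun e _ he => absurd ⟨e, he⟩ h⟩
  choose col hcol using hedge
  refine ⟨col, ⟨fun l hl => ?_, fun l hl l' hl' hne ⟨v, hv, hv'⟩ => ?_⟩, fun e l => hcol l e⟩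
  · obtain ⟨e, he⟩ := hD.exists_edge hl
    rw [← hcol l e hl he, ← List.mem_toFinset, ← hD.list_eq e hl he]
    exact hc.1 e
  · obtain ⟨e, he⟩ := hD.exists_edge hl
    obtain ⟨e', he'⟩ := hD.exists_edge hl'
    rw [← hcol l e hl he, ← hcol l' e' hl' he']
    rw [← he, Sym2.mem_map] at hv
    rw [← he', Sym2.mem_map] at hv'
    obtain ⟨u, hu, rfl⟩ := hv
    obtain ⟨u', hu', huu'⟩ := hv'
    obtain rfl := Fin.val_injective huu'
    refine hc.2 e e' (fun h => hne (hD.ends_injOn l hl l' hl' ?_)) ⟨u', hu, hu'⟩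
    rw [← he, ← he', h]

end IsSimple

end LabelledInstance

/-! ### Walks through a sequence of vertices -/

section Walks

variable {V : Type*} {G : SimpleGraph V} {w : ℕ → V} {m : ℕ}

theorem exists_walk_of_forall_adj (hw : ∀ k < m, G.Adj (w k) (w (k + 1))) :
    ∃ P : G.Walk (w 0) (w m), P.support = (List.range (m + 1)).map w ∧
      P.edges = (List.range m).map fun k => s(w k, w (k + 1)) := by
  induction m with
  | zero => exact ⟨.nil, rfl, rfl⟩
  | succ m ih =>
    obtain ⟨P, hsupport, hedges⟩ := ih fun k hk => hw k (by omega)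
    refine ⟨P.concat (hw m (by omega)), ?_, ?_⟩
    · simp only [SimpleGraph.Walk.support_concat, hsupport, List.range_succ (n := m + 1),
        List.map_append, List.map_cons, List.map_nil]
    · simp only [SimpleGraph.Walk.edges_concat, hedges, List.range_succ (n := m),
        List.map_append, List.concat_eq_append, List.map_cons, List.map_nil]

theorem existsUnique_mem_map_range {κ : Type*} {layer : V → κ} {x : κ}
    (hx : ∃! k, k < m ∧ layer (w k) = x) : ∃! y, y ∈ (List.range m).map w ∧ layer y = x := by
  obtain ⟨k, ⟨hk, hkx⟩, huniq⟩ := hx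
  refine ⟨w k, ⟨List.mem_map.2 ⟨k, List.mem_range.2 hk, rfl⟩, hkx⟩, ?_⟩
  rintro _ ⟨hy, hyx⟩
  obtain ⟨k', hk', rfl⟩ := List.mem_map.1 hy
  rw [huniq k' ⟨List.mem_range.1 hk', hyx⟩]

end Walks

/-- Consecutive edges of a path share a vertex, so that a coloring gives them different colors. -/
theorem ListEdgeColoringInstance.IsColoring.getElem_edges_ne {I : ListEdgeColoringInstance}
    {c : I.graph.edgeSet → ℕ} (hc : I.IsColoring c) {u v : Fin I.numVertices} {P : I.graph.Walk u v}
    (hP : P.IsPath) {k : ℕ} (hk : k + 1 < P.edges.length) :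
    c ⟨P.edges[k], P.edges_subset_edgeSet (List.getElem_mem _)⟩ ≠
      c ⟨P.edges[k + 1], P.edges_subset_edgeSet (List.getElem_mem hk)⟩ := by
  refine hc.2 _ _ (fun h => ?_) ⟨P.getVert (k + 1), ?_, ?_⟩
  · have := (hP.isTrail.edges_nodup.getElem_inj_iff).1 (congrArg Subtype.val h)
    omega
  · simp [SimpleGraph.Walk.getElem_edges]
  · simp [SimpleGraph.Walk.getElem_edges]

/-! ### The path gadget of a variable -/

/-- An edge of the path gadget of a variable. It joins the layers `lo` and `hi`, and its list holds
one color for each truth value of the variable; for the variable `i`, a pair `(x, e)` stands for the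
color `2 i + x + 2 n e`. In particular `(0, 0)` and `(1, 0)` are the colors `x_i` and `¬ x_i`. -/
structure GadgetEdge where
  lo : ℕ
  hi : ℕ
  ifTrue : ℕ × ℕ
  ifFalse : ℕ × ℕ
deriving DecidableEq

namespace GadgetEdge

/-- Five of the six possible edges between the layers `3 d, …, 3 d + 3`. The path in the two colors
of the variable follows the first three of them if the variable is true, and otherwise the fourth,
the second and the fifth. -/
def diamond (d : ℕ) : List GadgetEdge :=
  [⟨3 * d, 3 * d + 1, (d % 2, 0), (0, d + 1)⟩,
    ⟨3 * d + 1, 3 * d + 2, (1 - d % 2, 0), (d % 2, 0)⟩,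
    ⟨3 * d + 2, 3 * d + 3, (d % 2, 0), (1, d + 1)⟩,
    ⟨3 * d, 3 * d + 2, (1, d + 1), (1 - d % 2, 0)⟩,
    ⟨3 * d + 1, 3 * d + 3, (0, d + 1), (1 - d % 2, 0)⟩]

/-- The gadget: a chain of twenty diamonds and two more edges up to the last layer. -/
def all : List GadgetEdge :=
  (List.range 20).flatMap diamond ++ [⟨60, 61, (0, 0), (1, 0)⟩, ⟨61, 62, (1, 0), (0, 0)⟩]

/-- The color of an edge when the variable has the value `f`. -/
def pick (f : Bool) (τ : GadgetEdge) : ℕ × ℕ :=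
  if f then τ.ifTrue else τ.ifFalse

/-- The layers in the order in which the path in the two colors of the variable visits them. -/
def visit (f : Bool) (k : ℕ) : ℕ :=
  if f = true ∨ 60 ≤ k then k else if k % 3 = 1 then k + 1 else if k % 3 = 2 then k - 1 else k

/-- The two edges have a layer in common. -/
def Meets (τ τ' : GadgetEdge) : Prop :=
  τ.lo = τ'.lo ∨ τ.lo = τ'.hi ∨ τ.hi = τ'.lo ∨ τ.hi = τ'.hi

instance (τ τ' : GadgetEdge) : Decidable (Meets τ τ') := by
  unfold Meets; infer_instance

theorem bounds : ∀ τ ∈ all, τ.lo < τ.hi ∧ τ.hi < 63 ∧ τ.lo % 3 ≠ τ.hi % 3 := by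
  decide +kernel

theorem pick_bounds : ∀ f, ∀ τ ∈ all, (pick f τ).1 < 2 ∧ (pick f τ).2 ≤ 20 := by
  decide +kernel

theorem ifTrue_ne_ifFalse : ∀ τ ∈ all, τ.ifTrue ≠ τ.ifFalse := by
  decide +kernel

theorem pick_eq_or (f : Bool) (τ : GadgetEdge) : pick f τ = τ.ifTrue ∨ pick f τ = τ.ifFalse := by
  cases f <;> simp [pick]

theorem nodup_map_all : (all.map fun τ => s(τ.lo, τ.hi)).Nodup := by
  decide +kernel

theorem eq_of_meets_of_pick_eq : ∀ f, ∀ τ ∈ all, ∀ τ' ∈ all, Meets τ τ' → pick f τ = pick f τ' →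
    τ = τ' := by
  decide +kernel

theorem visit_lt (f : Bool) {k : ℕ} (hk : k < 63) : visit f k < 63 := by
  unfold visit; split_ifs <;> omega

theorem visit_visit (f : Bool) (k : ℕ) : visit f (visit f k) = k := by
  cases f
  · simp only [visit, Bool.false_eq_true, false_or]
    split_ifs <;> omega
  · simp [visit]

theorem exists_joins_visit : ∀ f, ∀ k < 62, ∃ τ ∈ all, (pick f τ).2 = 0 ∧
    s(τ.lo, τ.hi) = s(visit f k, visit f (k + 1)) := by
  decide +kernel

theorem exists_visit_joins : ∀ f, ∀ τ ∈ all, (pick f τ).2 = 0 → ∃ k < 62,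
    s(τ.lo, τ.hi) = s(visit f k, visit f (k + 1)) := by
  decide +kernel

/-! At the layer `3 d` the gadget uses the color `2 i + 2 n (d + 1)` if the variable is false and
the color `2 i + 1 + 2 n (d + 1)` if it is true. This is how the clauses see the value. -/

theorem pick_fst_of_port : ∀ f, ∀ τ ∈ all, ∀ d < 12, (pick f τ).2 = d + 1 →
    τ.lo = 3 * d ∨ τ.hi = 3 * d → (pick f τ).1 = if f then 1 else 0 := by
  decide +kernel

theorem exists_pick_of_port : ∀ f, ∀ d < 12, ∃ τ ∈ all, τ.lo = 3 * d ∧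
    pick f τ = (if f then 1 else 0, d + 1) := by
  decide +kernel

/-- The middle edge of the first diamond. -/
def first : GadgetEdge :=
  ⟨1, 2, (1, 0), (0, 0)⟩

/-- If `τ` has its color for the value `f` in a coloring, then so has `τ'`, because its other color
conflicts with `τ`. -/
def Forces (f : Bool) (τ τ' : GadgetEdge) : Prop :=
  τ ≠ τ' ∧ Meets τ τ' ∧ pick (!f) τ' = pick f τ

instance (f : Bool) (τ τ' : GadgetEdge) : Decidable (Forces f τ τ') := by
  unfold Forces; infer_instance

/-- An order of the gadget in which every edge is forced by an earlier one, starting with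
`first`. -/
def forcingOrder (f : Bool) : List GadgetEdge :=
  first :: ((List.range 20).flatMap fun d =>
    (if f then [3, 2, 1, 4, 0] else [0, 4, 1, 2, 3]).filterMap fun j => (diamond d)[j]?) ++ all

theorem first_mem : first ∈ all := by
  decide +kernel

theorem exists_forces : ∀ f, ∀ τ ∈ all, τ = first ∨ ∃ τ' ∈ all, Forces f τ' τ ∧
    (forcingOrder f).idxOf τ' < (forcingOrder f).idxOf τ := by
  decide +kernel

theorem exists_eq_pick {p : GadgetEdge → ℕ × ℕ}
    (hlist : ∀ τ ∈ all, p τ = τ.ifTrue ∨ p τ = τ.ifFalse)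
    (hproper : ∀ τ ∈ all, ∀ τ' ∈ all, τ ≠ τ' → Meets τ τ' → p τ ≠ p τ') :
    ∃ f, ∀ τ ∈ all, p τ = pick f τ := by
  have hpick (f : Bool) (τ) (hτ : τ ∈ all) (hne : p τ ≠ pick (!f) τ) : p τ = pick f τ := by
    cases f
    · exact (hlist τ hτ).resolve_left hne
    · exact (hlist τ hτ).resolve_right hne
  obtain ⟨f, hf⟩ : ∃ f, p first = pick f first :=
    (hlist first first_mem).elim (fun h => ⟨true, h⟩) fun h => ⟨false, h⟩
  refine ⟨f, fun τ hτ => ?_⟩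
  induction hr : (forcingOrder f).idxOf τ using Nat.strong_induction_on generalizing τ with
  | _ r ih =>
    obtain rfl | ⟨τ', hτ', ⟨hne, hmeets, hforces⟩, hlt⟩ := exists_forces f τ hτ
    · exact hf
    · refine hpick f τ hτ ?_
      rw [hforces, ← ih _ (hr ▸ hlt) τ' hτ' rfl]
      exact (hproper τ' hτ' τ hτ hne hmeets).symm

end GadgetEdge

/-! ### Formulas as tables of literal codes -/

theorem getD_flatMap_of_length_eq {α β : Type*} {f : α → List β} {q : ℕ}
    (hf : ∀ a, (f a).length = q) (l : List α) (d : β) {c j : ℕ} (hc : c < l.length) (hj : j < q) :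
    (l.flatMap f).getD (q * c + j) d = (f l[c]).getD j d := by
  induction l generalizing c with
  | nil => simp at hc
  | cons a l ih =>
    rw [List.flatMap_cons]
    cases c with
    | zero => rw [List.getD_append _ _ _ _ (by rw [hf]; omega)]; simp
    | succ c =>
      have hshift : q * (c + 1) + j - q = q * c + j := by rw [Nat.mul_succ]; omega
      rw [List.getD_append_right _ _ _ _ (by rw [hf, Nat.mul_succ]; omega), hf, hshift,
        ih (by simpa using hc), List.getElem_cons_succ]

namespace ThreeFourSAT

/-- The code of the `j`-th literal of the `c`-th clause, as it is read from the input word. -/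
def lit (φ : ThreeFourSAT) (c : ℕ) (j : Fin 3) : ℕ :=
  φ.word.getD (3 * c + 2 + j) 0

/-- The variable of the `j`-th literal of the `c`-th clause. -/
def var (φ : ThreeFourSAT) (c : ℕ) (j : Fin 3) : ℕ :=
  φ.lit c j / 2

/-- The number of clauses before the clause `c` that contain the variable `x`. -/
def occ (φ : ThreeFourSAT) (c x : ℕ) : ℕ :=
  Nat.count (fun c' => ∃ j, φ.var c' j = x) c

/-- The literal `j` of the clause `c` holds under the assignment `f`. -/
def Holds (φ : ThreeFourSAT) (f : ℕ → Bool) (c : ℕ) (j : Fin 3) : Prop :=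
  φ.lit c j % 2 = if f (φ.var c j) then 0 else 1

variable {φ : ThreeFourSAT} {c c' x : ℕ} {j j' : Fin 3}

theorem literalCode_div_two {n : ℕ} (l : Fin n × Bool) : literalCode l / 2 = l.1 := by
  unfold literalCode
  split_ifs <;> omega

theorem literalCode_mod_two {n : ℕ} (l : Fin n × Bool) :
    literalCode l % 2 = if l.2 then 0 else 1 := by
  unfold literalCode
  split_ifs <;> omega

theorem lit_eq_literalCode (hc : c < φ.clauses.length) (j : Fin 3) :
    φ.lit c j = literalCode (φ.clauses[c] j) := by
  have hword : φ.lit c j =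
      (φ.clauses.flatMap fun C => List.ofFn fun j => literalCode (C j)).getD (3 * c + j) 0 := by
    rw [lit, word, show 3 * c + 2 + (j : ℕ) = 3 * c + j + 1 + 1 by omega, List.getD_cons_succ,
      List.getD_cons_succ]
  rw [hword, getD_flatMap_of_length_eq (fun _ => List.length_ofFn) _ _ hc j.2]
  fin_cases j <;> rfl

theorem var_eq (hc : c < φ.clauses.length) (j : Fin 3) : φ.var c j = (φ.clauses[c] j).1 := by
  rw [var, lit_eq_literalCode hc, literalCode_div_two]

theorem var_lt (hc : c < φ.clauses.length) (j : Fin 3) : φ.var c j < φ.numVars :=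
  var_eq hc j ▸ (φ.clauses[c] j).1.2

theorem lit_eq_two_mul_var_add (φ : ThreeFourSAT) (c : ℕ) (j : Fin 3) :
    φ.lit c j = 2 * φ.var c j + φ.lit c j % 2 := by
  unfold var; omega

theorem var_injective (hc : c < φ.clauses.length) : Function.Injective (φ.var c) := by
  intro j j' h
  rw [var_eq hc, var_eq hc] at h
  exact φ.three_variables _ (List.getElem_mem hc) (Fin.ext h)

theorem satisfiable_iff_exists_holds :
    φ.Satisfiable ↔ ∃ f : ℕ → Bool, ∀ c < φ.clauses.length, ∃ j, φ.Holds f c j := by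
  have holds_iff (f : ℕ → Bool) {c} (hc : c < φ.clauses.length) (j : Fin 3) :
      φ.Holds f c j ↔ f (φ.clauses[c] j).1 = (φ.clauses[c] j).2 := by
    rw [Holds, var_eq hc, lit_eq_literalCode hc, literalCode_mod_two]
    cases f (φ.clauses[c] j).1 <;> cases (φ.clauses[c] j).2 <;> simp
  constructor
  · rintro ⟨f, hf⟩
    refine ⟨fun x => if h : x < φ.numVars then f ⟨x, h⟩ else true, fun c hc => ?_⟩
    obtain ⟨j, hj⟩ := hf φ.clauses[c] (List.getElem_mem _)
    exact ⟨j, (holds_iff _ hc j).2 (by simpa using hj)⟩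
  · rintro ⟨f, hf⟩
    refine ⟨fun x => f x, fun C hC => ?_⟩
    obtain ⟨c, hc, rfl⟩ := List.getElem_of_mem hC
    obtain ⟨j, hj⟩ := hf c hc
    exact ⟨j, (holds_iff f hc j).1 hj⟩

theorem occ_succ (φ : ThreeFourSAT) (c x : ℕ) :
    φ.occ (c + 1) x = φ.occ c x + if ∃ j, φ.var c j = x then 1 else 0 :=
  Nat.count_succ _ _

theorem occ_lt_occ (hc : c < c') (h : φ.var c j = x) : φ.occ c x < φ.occ c' x :=
  Nat.count_strict_mono ⟨j, h⟩ hc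

theorem occ_eq_countP (x : Fin φ.numVars) (hc : c ≤ φ.clauses.length) :
    φ.occ c x = (φ.clauses.take c).countP fun C => decide (∃ j, (C j).1 = x) := by
  induction c with
  | zero => rfl
  | succ c ih =>
    rw [occ_succ, ih (by omega), List.take_succ_eq_append_getElem (by omega), List.countP_append,
      List.countP_singleton]
    simp only [var_eq (Nat.lt_of_succ_le hc), Fin.val_inj, decide_eq_true_eq]

theorem occ_length_le (hx : x < φ.numVars) : φ.occ φ.clauses.length x ≤ 4 := by
  rw [occ_eq_countP ⟨x, hx⟩ le_rfl, List.take_length]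
  exact φ.at_most_four _

theorem occ_lt_four (hc : c < φ.clauses.length) (j : Fin 3) : φ.occ c (φ.var c j) < 4 :=
  (occ_lt_occ hc rfl).trans_le (occ_length_le (var_lt hc j))

theorem length_clauses_le (φ : ThreeFourSAT) : φ.clauses.length ≤ 4 * φ.numVars := by
  have hfiber : ∀ x ∈ Finset.range φ.numVars,
      ((Finset.range φ.clauses.length).filter fun c => φ.var c 0 = x).card ≤ 4 := by
    intro x hx
    refine le_trans ?_ (occ_length_le (Finset.mem_range.1 hx))
    rw [occ, Nat.count_eq_card_filter_range]
    exact Finset.card_le_card (Finset.monotone_filter_right _ fun c _ h => ⟨0, h⟩)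
  simpa using Finset.card_le_mul_card_image_of_maps_to
    (fun c hc => Finset.mem_range.2 (var_lt (Finset.mem_range.1 hc) 0)) 4 hfiber

end ThreeFourSAT

/-! ### The instance of a formula -/

theorem add_mul_eq_add_mul_iff {m u u' t t' : ℕ} (hu : u < m) (hu' : u' < m) :
    u + m * t = u' + m * t' ↔ u = u' ∧ t = t' := by
  refine ⟨fun h => ?_, fun h => h.1 ▸ h.2 ▸ rfl⟩
  have hmod := congrArg (· % m) h
  have hdiv := congrArg (· / m) h
  simp only [Nat.add_mul_mod_self_left, Nat.mod_eq_of_lt hu, Nat.mod_eq_of_lt hu'] at hmod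
  simp only [Nat.add_mul_div_left _ _ (Nat.zero_lt_of_lt hu), Nat.div_eq_of_lt hu,
    Nat.div_eq_of_lt hu', Nat.zero_add] at hdiv
  exact ⟨hmod, hdiv⟩

namespace ThreeFourSAT

/-- The side of a square grid with a cell for each variable. Every layer has at most twice as many
vertices on the paths of the variables. -/
def side (φ : ThreeFourSAT) : ℕ :=
  Nat.sqrt φ.numVars + 1

/-- The index, within its layer, of the vertex of the variable `i` in the layer `k`. Two variables
have equal indices for at most one residue of `k` modulo `3`, so their gadgets share no edge. -/
def layerIndex (φ : ThreeFourSAT) (i k : ℕ) : ℕ :=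
  if k % 3 = 0 then i / φ.side else if k % 3 = 1 then i % φ.side else i / φ.side + i % φ.side

/-- The vertex of the variable `i` in the layer `k`. The layer of a vertex is its residue
modulo `63`. -/
def vertex (φ : ThreeFourSAT) (i k : ℕ) : ℕ :=
  63 * φ.layerIndex i k + k

/-- The color that a pair in the path gadget of the variable `i` stands for. -/
def color (φ : ThreeFourSAT) (i : ℕ) (p : ℕ × ℕ) : ℕ :=
  2 * i + p.1 + 2 * φ.numVars * p.2

/-- The diamond, in the gadget of its variable, at which the literal `j` of the clause `c` is
tested. No other literal with this variable is tested there. -/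
def slot (φ : ThreeFourSAT) (c : ℕ) (j : Fin 3) : ℕ :=
  3 * φ.occ c (φ.var c j) + j

/-- The vertex at which the literal `j` of the clause `c` is tested. -/
def port (φ : ThreeFourSAT) (c : ℕ) (j : Fin 3) : ℕ :=
  φ.vertex (φ.var c j) (3 * φ.slot c j)

/-- The color of the edge for the literal `j` of the clause `c` that is also used by the gadget at
the port if the literal is false. -/
def litColor (φ : ThreeFourSAT) (c : ℕ) (j : Fin 3) : ℕ :=
  φ.color (φ.var c j) (φ.lit c j % 2, φ.slot c j + 1)

/-- The two clauses have a port in common, so that they need different vertices. -/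
def SharesPort (φ : ThreeFourSAT) (c c' : ℕ) : Prop :=
  ∃ j j', φ.port c j = φ.port c' j'

/-- The index of the vertex of a clause: the least one that is not taken by an earlier clause with a
common port. -/
noncomputable def place (φ : ThreeFourSAT) (c : ℕ) : ℕ :=
  sInf {t | ∀ c' (_ : c' < c), φ.SharesPort c' c → φ.place c' ≠ t}

/-- The index `t` is not taken by a clause before `c` that has a port in common with `c`. -/
def IsFree (φ : ThreeFourSAT) (c t : ℕ) : Prop :=
  ∀ c' < c, φ.SharesPort c' c → φ.place c' ≠ t

/-- The vertex of a clause. -/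
noncomputable def clauseVertex (φ : ThreeFourSAT) (c : ℕ) : ℕ :=
  63 * (2 * φ.side + φ.place c) + 1

/-- The instance of the formula. The label `inl (i, τ)` is the edge `τ` in the gadget of the
variable `i`, and `inr (c, j)` is the edge from the vertex of the clause `c` to its `j`-th port. -/
noncomputable def edgeColoring (φ : ThreeFourSAT) :
    LabelledInstance ((ℕ × GadgetEdge) ⊕ (ℕ × Fin 3)) where
  numVertices := 378 * φ.side
  labels := (List.range φ.numVars ×ˢ GadgetEdge.all).map Sum.inl ++
    (List.range φ.clauses.length ×ˢ List.finRange 3).map Sum.inr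
  left
    | .inl (i, τ) => φ.vertex i τ.lo
    | .inr (c, j) => φ.port c j
  right
    | .inl (i, τ) => φ.vertex i τ.hi
    | .inr (c, _) => φ.clauseVertex c
  colors
    | .inl (i, τ) => [φ.color i τ.ifTrue, φ.color i τ.ifFalse]
    | .inr (c, j) => [φ.litColor c j, 42 * φ.numVars + 2 * c, 42 * φ.numVars + 2 * c + 1]

variable {φ : ThreeFourSAT} {c c' i i' k k' : ℕ} {j j' : Fin 3} {τ : GadgetEdge}

theorem side_pos (φ : ThreeFourSAT) : 0 < φ.side :=
  Nat.succ_pos _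

theorem lt_side_iff : k < φ.side ↔ k * k ≤ φ.numVars :=
  Nat.lt_succ_iff.trans Nat.le_sqrt

theorem side_le (φ : ThreeFourSAT) : φ.side ≤ φ.numVars + 1 :=
  Nat.succ_le_succ (Nat.sqrt_le_self _)

theorem side_le_two_mul_sqrt (hφ : 1 ≤ φ.numVars) : (φ.side : ℝ) ≤ 2 * Real.sqrt φ.numVars := by
  have hsqrt : (Nat.sqrt φ.numVars : ℝ) ≤ Real.sqrt φ.numVars := Real.nat_sqrt_le_real_sqrt
  have hone : 1 ≤ Real.sqrt φ.numVars := Real.one_le_sqrt.2 (mod_cast hφ)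
  rw [side]
  push_cast
  linarith

theorem div_side_lt (hi : i < φ.numVars) : i / φ.side < φ.side :=
  Nat.div_lt_of_lt_mul (hi.trans (Nat.lt_succ_sqrt _))

theorem layerIndex_lt (hi : i < φ.numVars) (k : ℕ) : φ.layerIndex i k < 2 * φ.side := by
  have hdiv := div_side_lt hi
  have hmod := Nat.mod_lt i φ.side_pos
  unfold layerIndex
  split_ifs <;> omega

theorem eq_of_layerIndex_eq (hkk' : k % 3 ≠ k' % 3) (h : φ.layerIndex i k = φ.layerIndex i' k)
    (h' : φ.layerIndex i k' = φ.layerIndex i' k') : i = i' := by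
  have hdivmod : i / φ.side = i' / φ.side ∧ i % φ.side = i' % φ.side := by
    unfold layerIndex at h h'
    split_ifs at h h' <;> omega
  rw [← Nat.div_add_mod i φ.side, ← Nat.div_add_mod i' φ.side, hdivmod.1, hdivmod.2]

theorem vertex_mod (φ : ThreeFourSAT) (i : ℕ) (hk : k < 63) : φ.vertex i k % 63 = k := by
  unfold vertex; omega

theorem vertex_lt (hi : i < φ.numVars) (hk : k < 63) : φ.vertex i k < 63 * (2 * φ.side) := by
  have := layerIndex_lt hi k
  unfold vertex; omega

theorem eq_of_vertex_eq (hk : k < 63) (hk' : k' < 63) (h : φ.vertex i k = φ.vertex i' k') :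
    k = k' ∧ φ.layerIndex i k = φ.layerIndex i' k' := by
  unfold vertex at h; omega

theorem color_lt {p : ℕ × ℕ} (hi : i < φ.numVars) (hp₁ : p.1 < 2) (hp₂ : p.2 ≤ 20) :
    φ.color i p < 42 * φ.numVars := by
  have := Nat.mul_le_mul_left φ.numVars hp₂
  rw [color, mul_assoc]
  omega

theorem eq_of_color_eq {p p' : ℕ × ℕ} (hi : i < φ.numVars) (hi' : i' < φ.numVars) (hp : p.1 < 2)
    (hp' : p'.1 < 2) (h : φ.color i p = φ.color i' p') : i = i' ∧ p = p' := by
  obtain ⟨hfst, hsnd⟩ := (add_mul_eq_add_mul_iff (by omega : 2 * i + p.1 < 2 * φ.numVars)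
    (by omega : 2 * i' + p'.1 < 2 * φ.numVars)).1 h
  exact ⟨by omega, Prod.ext (by omega) hsnd⟩

theorem literalCode_true (i : Fin φ.numVars) : literalCode (i, true) = φ.color i (0, 0) := rfl

theorem literalCode_false (i : Fin φ.numVars) : literalCode (i, false) = φ.color i (1, 0) := rfl

theorem slot_lt (hc : c < φ.clauses.length) (j : Fin 3) : φ.slot c j < 12 := by
  have := occ_lt_four hc j
  unfold slot; omega

theorem eq_of_slot_eq (h : φ.slot c j = φ.slot c' j') : j = j' := by
  unfold slot at h; omega

theorem eq_of_var_eq_of_slot_eq (hvar : φ.var c j = φ.var c' j')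
    (hslot : φ.slot c j = φ.slot c' j') : c = c' := by
  have hocc : φ.occ c (φ.var c j) = φ.occ c' (φ.var c j) := by
    rw [slot, slot, ← hvar] at hslot; omega
  rcases lt_trichotomy c c' with h | h | h
  · exact absurd hocc (occ_lt_occ h rfl).ne
  · exact h
  · exact absurd hocc (occ_lt_occ h hvar.symm).ne'

theorem port_eq (φ : ThreeFourSAT) (c : ℕ) (j : Fin 3) :
    φ.port c j = 63 * (φ.var c j / φ.side) + 3 * φ.slot c j := by
  rw [port, vertex, layerIndex, if_pos (Nat.mul_mod_right 3 _)]

theorem port_mod (hc : c < φ.clauses.length) (j : Fin 3) : φ.port c j % 63 = 3 * φ.slot c j :=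
  vertex_mod _ _ (by have := slot_lt hc j; omega)

theorem port_lt (hc : c < φ.clauses.length) (j : Fin 3) : φ.port c j < 63 * φ.side := by
  have hdiv := div_side_lt (var_lt hc j)
  have hslot := slot_lt hc j
  rw [port_eq]
  omega

theorem eq_of_port_eq (hc : c < φ.clauses.length) (hc' : c' < φ.clauses.length)
    (h : φ.port c j = φ.port c' j') :
    φ.var c j / φ.side = φ.var c' j' / φ.side ∧ φ.slot c j = φ.slot c' j' := by
  have hslot := slot_lt hc j
  have hslot' := slot_lt hc' j'
  rw [port_eq, port_eq] at h
  omega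

theorem litColor_eq (φ : ThreeFourSAT) (c : ℕ) (j : Fin 3) :
    φ.litColor c j = φ.lit c j + 2 * φ.numVars * (φ.slot c j + 1) := by
  rw [litColor, color, ← lit_eq_two_mul_var_add]

theorem litColor_lt (hc : c < φ.clauses.length) (j : Fin 3) : φ.litColor c j < 42 * φ.numVars :=
  color_lt (var_lt hc j) (Nat.mod_lt _ two_pos) (by have := slot_lt hc j; simp only; omega)

/-! #### The vertices of the clauses -/

/-- The variables at a given port all have the same quotient by `side`, and so they differ in their
remainder. -/
theorem card_filter_port_eq_le (hc : c < φ.clauses.length) (j : Fin 3) :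
    ((Finset.range c).filter fun c' => φ.port c' j = φ.port c j).card ≤ φ.side := by
  have hport : ∀ c' ∈ (Finset.range c).filter fun c' => φ.port c' j = φ.port c j,
      φ.var c' j / φ.side = φ.var c j / φ.side ∧ φ.slot c' j = φ.slot c j := fun c' h => by
    rw [Finset.mem_filter, Finset.mem_range] at h
    exact eq_of_port_eq (h.1.trans hc) hc h.2
  refine (Finset.card_le_card_of_injOn (fun c' => φ.var c' j % φ.side) (fun c' _ => ?_) ?_).trans_eq
    (Finset.card_range _)
  · exact Finset.mem_coe.2 (Finset.mem_range.2 (Nat.mod_lt _ φ.side_pos))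
  · intro c₁ h₁ c₂ h₂ (hmod : φ.var c₁ j % φ.side = φ.var c₂ j % φ.side)
    obtain ⟨hdiv₁, hslot₁⟩ := hport c₁ h₁
    obtain ⟨hdiv₂, hslot₂⟩ := hport c₂ h₂
    refine eq_of_var_eq_of_slot_eq (j := j) (j' := j) ?_ (hslot₁.trans hslot₂.symm)
    rw [← Nat.div_add_mod (φ.var c₁ j) φ.side, ← Nat.div_add_mod (φ.var c₂ j) φ.side, hdiv₁, hdiv₂,
      hmod]

theorem exists_isFree (hc : c < φ.clauses.length) : ∃ t ≤ 3 * φ.side, φ.IsFree c t := by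
  let used := (Finset.univ.biUnion fun j =>
    (Finset.range c).filter fun c' => φ.port c' j = φ.port c j).image φ.place
  have hcard : used.card < (Finset.range (3 * φ.side + 1)).card := by
    have := Finset.card_biUnion_le_card_mul Finset.univ _ _ fun j _ => card_filter_port_eq_le hc j
    rw [Finset.card_univ, Fintype.card_fin] at this
    rw [Finset.card_range, Nat.lt_succ_iff]
    exact Finset.card_image_le.trans this
  obtain ⟨t, ht, hused⟩ := Finset.exists_mem_notMem_of_card_lt_card hcard
  refine ⟨t, Nat.lt_succ_iff.1 (Finset.mem_range.1 ht), ?_⟩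
  rintro c' hc' ⟨j', j, hport⟩ hplace
  obtain rfl := eq_of_slot_eq (eq_of_port_eq (hc'.trans hc) hc hport).2
  exact hused (Finset.mem_image.2 ⟨c', Finset.mem_biUnion.2
    ⟨j', Finset.mem_univ _, Finset.mem_filter.2 ⟨Finset.mem_range.2 hc', hport⟩⟩, hplace⟩)

theorem place_eq_sInf (φ : ThreeFourSAT) (c : ℕ) : φ.place c = sInf {t | φ.IsFree c t} := by
  rw [place]; rfl

theorem isFree_place (hc : c < φ.clauses.length) : φ.IsFree c (φ.place c) := by
  obtain ⟨t, -, ht⟩ := exists_isFree hc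
  rw [place_eq_sInf]
  exact Nat.sInf_mem (s := {t | φ.IsFree c t}) ⟨t, ht⟩

theorem not_isFree_of_lt_place {t : ℕ} (ht : t < φ.place c) : ¬ φ.IsFree c t :=
  Nat.notMem_of_lt_sInf (place_eq_sInf φ c ▸ ht)

theorem place_le (hc : c < φ.clauses.length) : φ.place c ≤ 3 * φ.side := by
  obtain ⟨t, hle, ht⟩ := exists_isFree hc
  exact (not_lt.1 fun h => not_isFree_of_lt_place h ht).trans hle

theorem eq_of_port_eq_of_place_eq (hc : c < φ.clauses.length) (hc' : c' < φ.clauses.length)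
    (hport : φ.port c j = φ.port c' j') (hplace : φ.place c = φ.place c') : c = c' := by
  rcases lt_trichotomy c c' with h | h | h
  · exact absurd hplace (isFree_place hc' c h ⟨j, j', hport⟩)
  · exact h
  · exact absurd hplace.symm (isFree_place hc c' h ⟨j', j, hport.symm⟩)

theorem clauseVertex_lt (hc : c < φ.clauses.length) : φ.clauseVertex c < 378 * φ.side := by
  have hplace := place_le hc
  have hside := φ.side_pos
  unfold clauseVertex; omega

theorem le_clauseVertex (φ : ThreeFourSAT) (c : ℕ) : 63 * (2 * φ.side) ≤ φ.clauseVertex c := by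
  unfold clauseVertex; omega

theorem clauseVertex_mod (φ : ThreeFourSAT) (c : ℕ) : φ.clauseVertex c % 63 = 1 := by
  unfold clauseVertex; omega

/-! #### The instance is well formed -/

theorem inl_mem_labels :
    Sum.inl (i, τ) ∈ φ.edgeColoring.labels ↔ i < φ.numVars ∧ τ ∈ GadgetEdge.all := by
  simp [edgeColoring]

theorem inr_mem_labels : Sum.inr (c, j) ∈ φ.edgeColoring.labels ↔ c < φ.clauses.length := by
  simp [edgeColoring]

theorem ends_inl (φ : ThreeFourSAT) (i : ℕ) (τ : GadgetEdge) :
    φ.edgeColoring.ends (.inl (i, τ)) = s(φ.vertex i τ.lo, φ.vertex i τ.hi) := rfl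

theorem ends_inr (φ : ThreeFourSAT) (c : ℕ) (j : Fin 3) :
    φ.edgeColoring.ends (.inr (c, j)) = s(φ.port c j, φ.clauseVertex c) := rfl

theorem nodup_labels (φ : ThreeFourSAT) : φ.edgeColoring.labels.Nodup := by
  refine List.Nodup.append ?_ ?_ ?_
  · exact (List.nodup_range.product (.of_map _ GadgetEdge.nodup_map_all)).map Sum.inl_injective
  · exact (List.nodup_range.product (List.nodup_finRange 3)).map Sum.inr_injective
  · simp [List.Disjoint]

theorem lt_of_mem_ends_inl {v : ℕ} (hi : i < φ.numVars) (hτ : τ ∈ GadgetEdge.all)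
    (hv : v ∈ φ.edgeColoring.ends (.inl (i, τ))) :
    v < 63 * (2 * φ.side) ∧ (v % 63 = τ.lo ∨ v % 63 = τ.hi) := by
  have := GadgetEdge.bounds τ hτ
  rw [ends_inl, Sym2.mem_iff] at hv
  rcases hv with rfl | rfl
  · exact ⟨vertex_lt hi (by omega), Or.inl (vertex_mod _ _ (by omega))⟩
  · exact ⟨vertex_lt hi (by omega), Or.inr (vertex_mod _ _ (by omega))⟩

theorem left_mod_ne_right_mod : ∀ l ∈ φ.edgeColoring.labels,
    φ.edgeColoring.left l % 63 ≠ φ.edgeColoring.right l % 63 := by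
  rintro (⟨i, τ⟩ | ⟨c, j⟩) h
  · have := GadgetEdge.bounds τ (inl_mem_labels.1 h).2
    simp only [edgeColoring]
    rw [vertex_mod _ _ (by omega), vertex_mod _ _ (by omega)]
    omega
  · simp only [edgeColoring]
    rw [port_mod (inr_mem_labels.1 h), clauseVertex_mod]
    omega

theorem nodup_colors : ∀ l ∈ φ.edgeColoring.labels, (φ.edgeColoring.colors l).Nodup := by
  rintro (⟨i, τ⟩ | ⟨c, j⟩) h
  · obtain ⟨hi, hτ⟩ := inl_mem_labels.1 h
    refine List.nodup_cons.2 ⟨fun h => ?_, List.nodup_singleton _⟩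
    exact GadgetEdge.ifTrue_ne_ifFalse τ hτ (eq_of_color_eq hi hi
      (GadgetEdge.pick_bounds true τ hτ).1 (GadgetEdge.pick_bounds false τ hτ).1
      (List.mem_singleton.1 h)).2
  · have := litColor_lt (inr_mem_labels.1 h) j
    simp only [edgeColoring, List.nodup_cons, List.mem_cons, List.not_mem_nil, or_false,
      not_false_eq_true, List.nodup_nil, and_true]
    omega

theorem ends_inl_ne_ends_inr (hi : i < φ.numVars) (hτ : τ ∈ GadgetEdge.all) :
    φ.edgeColoring.ends (.inl (i, τ)) ≠ φ.edgeColoring.ends (.inr (c, j)) := by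
  intro h
  refine (φ.le_clauseVertex c).not_gt (lt_of_mem_ends_inl hi hτ (h ▸ ?_)).1
  rw [ends_inr]
  exact Sym2.mem_mk_right _ _

theorem eq_of_ends_inl_eq {τ' : GadgetEdge} (hτ : τ ∈ GadgetEdge.all) (hτ' : τ' ∈ GadgetEdge.all)
    (h : φ.edgeColoring.ends (.inl (i, τ)) = φ.edgeColoring.ends (.inl (i', τ'))) :
    i = i' ∧ τ = τ' := by
  have hb := GadgetEdge.bounds τ hτ
  have hb' := GadgetEdge.bounds τ' hτ'
  obtain rfl : τ = τ' := by
    refine List.inj_on_of_nodup_map GadgetEdge.nodup_map_all hτ hτ' ?_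
    have := congrArg (Sym2.map (· % 63)) h
    rwa [ends_inl, ends_inl, Sym2.map_mk, Sym2.map_mk, vertex_mod _ _ (by omega),
      vertex_mod _ _ (by omega), vertex_mod _ _ (by omega), vertex_mod _ _ (by omega)] at this
  rw [ends_inl, ends_inl, Sym2.eq_iff] at h
  rcases h with ⟨hlo, hhi⟩ | ⟨hlo, -⟩
  · exact ⟨eq_of_layerIndex_eq hb.2.2 (eq_of_vertex_eq (by omega) (by omega) hlo).2
      (eq_of_vertex_eq (by omega) (by omega) hhi).2, rfl⟩
  · have := (eq_of_vertex_eq (by omega) (by omega) hlo).1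
    omega

theorem eq_of_ends_inr_eq (hc : c < φ.clauses.length) (hc' : c' < φ.clauses.length)
    (h : φ.edgeColoring.ends (.inr (c, j)) = φ.edgeColoring.ends (.inr (c', j'))) :
    c = c' ∧ j = j' := by
  rw [ends_inr, ends_inr, Sym2.eq_iff] at h
  have hport := port_lt hc j
  have hvertex := φ.le_clauseVertex c'
  obtain ⟨hport, hvertex⟩ := h.resolve_right (by omega)
  refine ⟨eq_of_port_eq_of_place_eq hc hc' hport ?_, eq_of_slot_eq (eq_of_port_eq hc hc' hport).2⟩
  unfold clauseVertex at hvertex; omega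

theorem isSimple (φ : ThreeFourSAT) : φ.edgeColoring.IsSimple where
  left_lt := by
    rintro (⟨i, τ⟩ | ⟨c, j⟩) h
    · obtain ⟨hi, hτ⟩ := inl_mem_labels.1 h
      have := (lt_of_mem_ends_inl hi hτ (Sym2.mem_mk_left _ _)).1
      simp only [edgeColoring] at this ⊢; omega
    · have := port_lt (inr_mem_labels.1 h) j
      simp only [edgeColoring]; omega
  right_lt := by
    rintro (⟨i, τ⟩ | ⟨c, j⟩) h
    · obtain ⟨hi, hτ⟩ := inl_mem_labels.1 h
      have := (lt_of_mem_ends_inl hi hτ (Sym2.mem_mk_right _ _)).1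
      simp only [edgeColoring] at this ⊢; omega
    · exact clauseVertex_lt (inr_mem_labels.1 h)
  left_ne_right l hl h := left_mod_ne_right_mod l hl (congrArg (· % 63) h)
  nodup_colors := nodup_colors
  nodup_labels := φ.nodup_labels
  ends_injOn := by
    rintro (⟨i, τ⟩ | ⟨c, j⟩) h (⟨i', τ'⟩ | ⟨c', j'⟩) h' heq <;>
      simp only [inl_mem_labels, inr_mem_labels] at h h'
    · obtain ⟨rfl, rfl⟩ := eq_of_ends_inl_eq h.2 h'.2 heq
      rfl
    · exact absurd heq (ends_inl_ne_ends_inr h.1 h.2)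
    · exact absurd heq.symm (ends_inl_ne_ends_inr h'.1 h'.2)
    · obtain ⟨rfl, rfl⟩ := eq_of_ends_inr_eq h h' heq
      rfl

end ThreeFourSAT

/-! ### Colorings and assignments -/

namespace ThreeFourSAT

/-- The coloring for an assignment `f` and a choice `g` of a true literal in every clause. -/
def coloringOf (φ : ThreeFourSAT) (f : ℕ → Bool) (g : ℕ → Fin 3) :
    (ℕ × GadgetEdge) ⊕ (ℕ × Fin 3) → ℕ
  | .inl (i, τ) => φ.color i (τ.pick (f i))
  | .inr (c, j) =>
    if j = g c then φ.litColor c j else 42 * φ.numVars + 2 * c + if j + 1 = g c then 1 else 0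

variable {φ : ThreeFourSAT} {f : ℕ → Bool} {g : ℕ → Fin 3} {c c' i i' v : ℕ} {j j' : Fin 3}
  {τ τ' : GadgetEdge}

theorem meets_iff_exists_mem_ends (hi : i < φ.numVars) (hτ : τ ∈ GadgetEdge.all)
    (hτ' : τ' ∈ GadgetEdge.all) : τ.Meets τ' ↔
      ∃ v, v ∈ φ.edgeColoring.ends (.inl (i, τ)) ∧ v ∈ φ.edgeColoring.ends (.inl (i, τ')) := by
  constructor
  · simp only [ends_inl, Sym2.mem_iff]
    rintro (h | h | h | h)
    · exact ⟨φ.vertex i τ.lo, Or.inl rfl, Or.inl (h ▸ rfl)⟩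
    · exact ⟨φ.vertex i τ.lo, Or.inl rfl, Or.inr (h ▸ rfl)⟩
    · exact ⟨φ.vertex i τ.hi, Or.inr rfl, Or.inl (h ▸ rfl)⟩
    · exact ⟨φ.vertex i τ.hi, Or.inr rfl, Or.inr (h ▸ rfl)⟩
  · rintro ⟨v, hv, hv'⟩
    have hmod := (lt_of_mem_ends_inl hi hτ hv).2
    have hmod' := (lt_of_mem_ends_inl hi hτ' hv').2
    unfold GadgetEdge.Meets; omega

theorem color_pick_lt (hi : i < φ.numVars) (hτ : τ ∈ GadgetEdge.all) (b : Bool) :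
    φ.color i (τ.pick b) < 42 * φ.numVars :=
  color_lt hi (GadgetEdge.pick_bounds b τ hτ).1 (GadgetEdge.pick_bounds b τ hτ).2

theorem eq_of_color_pick_eq (hi : i < φ.numVars) (hi' : i' < φ.numVars) (hτ : τ ∈ GadgetEdge.all)
    (hτ' : τ' ∈ GadgetEdge.all) (hv : v ∈ φ.edgeColoring.ends (.inl (i, τ)))
    (hv' : v ∈ φ.edgeColoring.ends (.inl (i', τ')))
    (h : φ.color i (τ.pick (f i)) = φ.color i' (τ'.pick (f i'))) : i = i' ∧ τ = τ' := by
  obtain ⟨rfl, hpick⟩ := eq_of_color_eq hi hi' (GadgetEdge.pick_bounds _ τ hτ).1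
    (GadgetEdge.pick_bounds _ τ' hτ').1 h
  exact ⟨rfl, GadgetEdge.eq_of_meets_of_pick_eq (f i) τ hτ τ' hτ'
    ((meets_iff_exists_mem_ends hi hτ hτ').2 ⟨v, hv, hv'⟩) hpick⟩

theorem color_pick_ne_litColor (hi : i < φ.numVars) (hτ : τ ∈ GadgetEdge.all)
    (hc : c < φ.clauses.length) (hv : v ∈ φ.edgeColoring.ends (.inl (i, τ)))
    (hv' : v ∈ φ.edgeColoring.ends (.inr (c, j))) (hj : φ.Holds f c j) :
    φ.color i (τ.pick (f i)) ≠ φ.litColor c j := by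
  intro h
  obtain ⟨hlt, hmod⟩ := lt_of_mem_ends_inl hi hτ hv
  obtain rfl : v = φ.port c j := by
    have := φ.le_clauseVertex c
    rw [ends_inr, Sym2.mem_iff] at hv'
    exact hv'.resolve_right (by omega)
  rw [port_mod hc] at hmod
  obtain ⟨rfl, hpick⟩ := eq_of_color_eq hi (var_lt hc j) (GadgetEdge.pick_bounds _ τ hτ).1
    (Nat.mod_lt _ two_pos) h
  have hvalue := GadgetEdge.pick_fst_of_port _ τ hτ _ (slot_lt hc j) (congrArg Prod.snd hpick)
    (hmod.imp Eq.symm Eq.symm)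
  rw [hpick] at hvalue
  cases hf : f (φ.var c j) <;>
    simp only [Holds, hf, Bool.false_eq_true, ↓reduceIte] at hj hvalue <;> omega

theorem eq_of_litColor_eq (hc : c < φ.clauses.length) (hc' : c' < φ.clauses.length)
    (h : φ.litColor c j = φ.litColor c' j') : c = c' ∧ j = j' := by
  obtain ⟨hvar, hpair⟩ := eq_of_color_eq (var_lt hc j) (var_lt hc' j') (Nat.mod_lt _ two_pos)
    (Nat.mod_lt _ two_pos) h
  have hslot : φ.slot c j = φ.slot c' j' := Nat.succ_injective (congrArg Prod.snd hpair)
  exact ⟨eq_of_var_eq_of_slot_eq hvar hslot, eq_of_slot_eq hslot⟩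

theorem eq_of_coloringOf_inr_eq (hc : c < φ.clauses.length) (hc' : c' < φ.clauses.length)
    (h : φ.coloringOf f g (.inr (c, j)) = φ.coloringOf f g (.inr (c', j'))) : c = c' ∧ j = j' := by
  have hlt := litColor_lt hc j
  have hlt' := litColor_lt hc' j'
  simp only [coloringOf] at h
  by_cases hj : j = g c <;> by_cases hj' : j' = g c' <;> simp only [hj, hj', if_true, if_false] at h
  · rw [← hj, ← hj'] at h
    exact eq_of_litColor_eq hc hc' h
  · subst hj; omega
  · subst hj'; omega
  · obtain rfl : c = c' := by split_ifs at h <;> omega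
    refine ⟨rfl, ?_⟩
    split_ifs at h <;> omega

theorem coloringOf_inl_ne_inr (hg : ∀ c < φ.clauses.length, φ.Holds f c (g c)) (hi : i < φ.numVars)
    (hτ : τ ∈ GadgetEdge.all) (hc : c < φ.clauses.length)
    (hv : v ∈ φ.edgeColoring.ends (.inl (i, τ))) (hv' : v ∈ φ.edgeColoring.ends (.inr (c, j))) :
    φ.coloringOf f g (.inl (i, τ)) ≠ φ.coloringOf f g (.inr (c, j)) := by
  simp only [coloringOf]
  split_ifs with hj
  · exact color_pick_ne_litColor hi hτ hc hv hv' (hj ▸ hg c hc)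
  all_goals
    have := color_pick_lt hi hτ (f i)
    omega

theorem isColoring_coloringOf (hg : ∀ c < φ.clauses.length, φ.Holds f c (g c)) :
    φ.edgeColoring.IsColoring (φ.coloringOf f g) := by
  constructor
  · rintro (⟨i, τ⟩ | ⟨c, j⟩) -
    · simpa [edgeColoring, coloringOf] using
        (τ.pick_eq_or (f i)).imp (congrArg (φ.color i)) (congrArg (φ.color i))
    · simp only [edgeColoring, coloringOf]
      split_ifs <;> simp
  · rintro (⟨i, τ⟩ | ⟨c, j⟩) h (⟨i', τ'⟩ | ⟨c', j'⟩) h' hne ⟨v, hv, hv'⟩ heq <;>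
      simp only [inl_mem_labels, inr_mem_labels] at h h'
    · obtain ⟨rfl, rfl⟩ := eq_of_color_pick_eq h.1 h'.1 h.2 h'.2 hv hv' heq
      exact hne rfl
    · exact coloringOf_inl_ne_inr hg h.1 h.2 h' hv hv' heq
    · exact coloringOf_inl_ne_inr hg h'.1 h'.2 h hv' hv heq.symm
    · obtain ⟨rfl, rfl⟩ := eq_of_coloringOf_inr_eq h h' heq
      exact hne rfl

variable {col : (ℕ × GadgetEdge) ⊕ (ℕ × Fin 3) → ℕ}

theorem exists_eq_color_pick (hcol : φ.edgeColoring.IsColoring col) : ∃ f : ℕ → Bool,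
    ∀ i < φ.numVars, ∀ τ ∈ GadgetEdge.all, col (.inl (i, τ)) = φ.color i (τ.pick (f i)) := by
  suffices h : ∀ i < φ.numVars, ∃ b, ∀ τ ∈ GadgetEdge.all,
      col (.inl (i, τ)) = φ.color i (τ.pick b) by
    choose! f hf using h
    exact ⟨f, hf⟩
  intro i hi
  have hpair (τ) (hτ : τ ∈ GadgetEdge.all) :
      ∃ q, (q = τ.ifTrue ∨ q = τ.ifFalse) ∧ col (.inl (i, τ)) = φ.color i q := by
    have := hcol.1 _ (inl_mem_labels.2 ⟨hi, hτ⟩)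
    simpa [edgeColoring] using this
  choose! p hlist hp using hpair
  obtain ⟨b, hb⟩ := GadgetEdge.exists_eq_pick hlist fun τ hτ τ' hτ' hne hmeets heq =>
    hcol.2 _ (inl_mem_labels.2 ⟨hi, hτ⟩) _ (inl_mem_labels.2 ⟨hi, hτ'⟩) (by simpa using hne)
      ((meets_iff_exists_mem_ends hi hτ hτ').1 hmeets) (by rw [hp τ hτ, hp τ' hτ', heq])
  exact ⟨b, fun τ hτ => hb τ hτ ▸ hp τ hτ⟩

theorem holds_of_eq_litColor (hcol : φ.edgeColoring.IsColoring col)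
    (hf : ∀ i < φ.numVars, ∀ τ ∈ GadgetEdge.all, col (.inl (i, τ)) = φ.color i (τ.pick (f i)))
    (hc : c < φ.clauses.length) (hj : col (.inr (c, j)) = φ.litColor c j) : φ.Holds f c j := by
  by_contra hfalse
  obtain ⟨τ, hτ, hlo, hpick⟩ := GadgetEdge.exists_pick_of_port (f (φ.var c j)) _ (slot_lt hc j)
  refine hcol.2 _ (inl_mem_labels.2 ⟨var_lt hc j, hτ⟩) _ (inr_mem_labels.2 hc) Sum.inl_ne_inr
    ⟨φ.port c j, ?_, Sym2.mem_mk_left _ _⟩ ?_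
  · rw [ends_inl, hlo]
    exact Sym2.mem_mk_left _ _
  · rw [hf _ (var_lt hc j) τ hτ, hj, hpick, litColor]
    congr 2
    unfold Holds at hfalse
    split_ifs at hfalse ⊢ <;> omega

theorem exists_eq_litColor (hcol : φ.edgeColoring.IsColoring col) (hc : c < φ.clauses.length) :
    ∃ j, col (.inr (c, j)) = φ.litColor c j := by
  by_contra! hne
  have htwo (j) : col (.inr (c, j)) = 42 * φ.numVars + 2 * c ∨
      col (.inr (c, j)) = 42 * φ.numVars + 2 * c + 1 := by
    have := hcol.1 _ (inr_mem_labels.2 hc : Sum.inr (c, j) ∈ _)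
    simp only [edgeColoring, List.mem_cons, List.not_mem_nil, or_false] at this
    exact this.resolve_left (hne j)
  have hdistinct {j j' : Fin 3} (hjj' : j ≠ j') : col (.inr (c, j)) ≠ col (.inr (c, j')) :=
    hcol.2 _ (inr_mem_labels.2 hc) _ (inr_mem_labels.2 hc) (by simpa using hjj')
      ⟨φ.clauseVertex c, Sym2.mem_mk_right _ _, Sym2.mem_mk_right _ _⟩
  have h₀ := htwo 0
  have h₁ := htwo 1
  have h₂ := htwo 2
  have h₀₁ := hdistinct (show (0 : Fin 3) ≠ 1 by decide)
  have h₀₂ := hdistinct (show (0 : Fin 3) ≠ 2 by decide)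
  have h₁₂ := hdistinct (show (1 : Fin 3) ≠ 2 by decide)
  omega

theorem satisfiable_iff_colorable (φ : ThreeFourSAT) :
    φ.Satisfiable ↔ φ.edgeColoring.toInstance.Colorable := by
  rw [satisfiable_iff_exists_holds]
  constructor
  · rintro ⟨f, hf⟩
    choose! g hg using hf
    exact φ.isSimple.colorable (isColoring_coloringOf hg)
  · rintro ⟨c, hc⟩
    obtain ⟨col, hcol, -⟩ := φ.isSimple.exists_isColoring hc
    obtain ⟨f, hf⟩ := exists_eq_color_pick hcol
    exact ⟨f, fun c hc => (exists_eq_litColor hcol hc).imp fun j => holds_of_eq_litColor hcol hf hc⟩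

/-! ### The alternating paths -/

theorem eq_literalCode_iff (hcol : φ.edgeColoring.IsColoring col)
    (hf : ∀ i < φ.numVars, ∀ τ ∈ GadgetEdge.all, col (.inl (i, τ)) = φ.color i (τ.pick (f i)))
    (i : Fin φ.numVars) {l} (hl : l ∈ φ.edgeColoring.labels) :
    col l = literalCode (i, true) ∨ col l = literalCode (i, false) ↔
      ∃ τ ∈ GadgetEdge.all, (τ.pick (f i)).2 = 0 ∧ l = .inl (↑i, τ) := by
  rw [literalCode_true, literalCode_false]
  constructor
  · intro h
    obtain ⟨x, hx, h⟩ : ∃ x < 2, col l = φ.color i (x, 0) :=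
      h.elim (fun h => ⟨0, two_pos, h⟩) fun h => ⟨1, one_lt_two, h⟩
    rcases l with ⟨i', τ⟩ | ⟨c, j⟩
    · obtain ⟨hi', hτ⟩ := inl_mem_labels.1 hl
      rw [hf i' hi' τ hτ] at h
      obtain ⟨rfl, hpick⟩ := eq_of_color_eq hi' i.2 (GadgetEdge.pick_bounds _ τ hτ).1 hx h
      exact ⟨τ, hτ, congrArg Prod.snd hpick, rfl⟩
    · have hlt := color_lt (φ := φ) (p := (x, 0)) i.2 hx (Nat.zero_le _)
      have hmem := hcol.1 _ hl
      simp only [edgeColoring, List.mem_cons, List.not_mem_nil, or_false] at hmem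
      have hlit := (hmem.resolve_right (by omega)).symm.trans h
      have := eq_of_color_eq (var_lt (inr_mem_labels.1 hl) j) i.2 (Nat.mod_lt _ two_pos) hx hlit
      exact absurd (congrArg Prod.snd this.2) (Nat.succ_ne_zero _)
  · rintro ⟨τ, hτ, hsnd, rfl⟩
    have hfst := (GadgetEdge.pick_bounds (f i) τ hτ).1
    rw [hf i i.2 τ hτ, ← Prod.mk.eta (p := τ.pick (f i)), hsnd]
    interval_cases (τ.pick (f i)).1
    · exact Or.inl rfl
    · exact Or.inr rfl

/-- The layer of a vertex. -/
def layer (φ : ThreeFourSAT) (v : Fin φ.edgeColoring.toInstance.numVertices) : Fin 63 :=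
  ⟨v % 63, Nat.mod_lt _ (by decide)⟩

theorem layer_ne_of_adj {u v : Fin φ.edgeColoring.toInstance.numVertices}
    (huv : φ.edgeColoring.toInstance.graph.Adj u v) : φ.layer u ≠ φ.layer v := by
  obtain ⟨l, hl, hends⟩ := (φ.isSimple.mem_edgeSet_iff s(u, v)).1 huv
  have hne := left_mod_ne_right_mod l hl
  rw [Sym2.map_mk, LabelledInstance.ends, Sym2.eq_iff] at hends
  intro h
  have hmod := congrArg Fin.val h
  simp only [layer] at hmod
  omega

theorem exists_walk_visit (hi : i < φ.numVars) (b : Bool) :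
    ∃ w : ℕ → Fin φ.edgeColoring.toInstance.numVertices,
      (∀ k < 63, (w k : ℕ) = φ.vertex i (GadgetEdge.visit b k)) ∧
      ∃ P : φ.edgeColoring.toInstance.graph.Walk (w 0) (w 62),
        P.support = (List.range 63).map w ∧
        ∀ e, e ∈ P.edges ↔ ∃ τ ∈ GadgetEdge.all, (τ.pick b).2 = 0 ∧
          e.map Fin.val = φ.edgeColoring.ends (.inl (i, τ)) := by
  have hlt {k : ℕ} (hk : k < 63) :
      φ.vertex i (GadgetEdge.visit b k) < φ.edgeColoring.toInstance.numVertices :=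
    (vertex_lt hi (GadgetEdge.visit_lt b hk)).trans_le
      (show 63 * (2 * φ.side) ≤ 378 * φ.side by omega)
  let w (k : ℕ) : Fin φ.edgeColoring.toInstance.numVertices :=
    ⟨φ.vertex i (GadgetEdge.visit b (min k 62)), hlt (by omega)⟩
  have hw (k) (hk : k < 63) : (w k : ℕ) = φ.vertex i (GadgetEdge.visit b k) := by
    simp only [w, min_eq_left (Nat.le_of_lt_succ hk)]
  have hends {k} (hk : k < 62) {τ : GadgetEdge}
      (hjoins : s(τ.lo, τ.hi) = s(GadgetEdge.visit b k, GadgetEdge.visit b (k + 1))) :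
      s(w k, w (k + 1)).map Fin.val = φ.edgeColoring.ends (.inl (i, τ)) := by
    rw [Sym2.map_mk, hw k (by omega), hw (k + 1) (by omega)]
    exact congrArg (Sym2.map (φ.vertex i)) hjoins.symm
  have hadj (k) (hk : k < 62) : φ.edgeColoring.toInstance.graph.Adj (w k) (w (k + 1)) := by
    obtain ⟨τ, hτ, -, hjoins⟩ := GadgetEdge.exists_joins_visit b k hk
    exact (φ.isSimple.mem_edgeSet_iff s(w k, w (k + 1))).2
      ⟨.inl (i, τ), inl_mem_labels.2 ⟨hi, hτ⟩, hends hk hjoins⟩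
  obtain ⟨P, hsupport, hedges⟩ := exists_walk_of_forall_adj hadj
  refine ⟨w, hw, P, hsupport, fun e => ?_⟩
  rw [hedges, List.mem_map]
  constructor
  · rintro ⟨k, hk, rfl⟩
    obtain ⟨τ, hτ, hpick, hjoins⟩ := GadgetEdge.exists_joins_visit b k (List.mem_range.1 hk)
    exact ⟨τ, hτ, hpick, hends (List.mem_range.1 hk) hjoins⟩
  · rintro ⟨τ, hτ, hpick, he⟩
    obtain ⟨k, hk, hjoins⟩ := GadgetEdge.exists_visit_joins b τ hτ hpick
    exact ⟨k, List.mem_range.2 hk,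
      Sym2.map.injective Fin.val_injective ((hends hk hjoins).trans he.symm)⟩

theorem exists_isPath (hi : i < φ.numVars) (b : Bool) :
    ∃ (u v : _) (P : φ.edgeColoring.toInstance.graph.Walk u v), P.IsPath ∧
      φ.layer u = 0 ∧ φ.layer v = 62 ∧ (∀ k, ∃! y, y ∈ P.support ∧ φ.layer y = k) ∧
      ∀ e, e ∈ P.edges ↔ ∃ τ ∈ GadgetEdge.all, (τ.pick b).2 = 0 ∧
        e.map Fin.val = φ.edgeColoring.ends (.inl (i, τ)) := by
  obtain ⟨w, hw, P, hsupport, hedges⟩ := exists_walk_visit hi b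
  have hlayer (k) (hk : k < 63) : (φ.layer (w k) : ℕ) = GadgetEdge.visit b k := by
    simp only [layer, hw k hk, vertex_mod _ _ (GadgetEdge.visit_lt b hk)]
  have hinj (k) (hk : k < 63) (k') (hk' : k' < 63) (h : φ.layer (w k) = φ.layer (w k')) :
      k = k' := by
    rw [← GadgetEdge.visit_visit b k, ← hlayer k hk, h, hlayer k' hk', GadgetEdge.visit_visit]
  refine ⟨w 0, w 62, P, .mk' ?_, ?_, ?_, fun x => ?_, hedges⟩
  · rw [hsupport]
    exact List.nodup_range.map_on fun k hk k' hk' h =>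
      hinj k (List.mem_range.1 hk) k' (List.mem_range.1 hk') (congrArg φ.layer h)
  · exact Fin.ext ((hlayer 0 (by decide)).trans (by cases b <;> rfl))
  · exact Fin.ext ((hlayer 62 (by decide)).trans (by cases b <;> rfl))
  · rw [hsupport]
    have hx := GadgetEdge.visit_lt b x.2
    have hvisit : φ.layer (w (GadgetEdge.visit b x)) = x :=
      Fin.ext ((hlayer _ hx).trans (GadgetEdge.visit_visit b x))
    exact existsUnique_mem_map_range
      ⟨_, ⟨hx, hvisit⟩, fun k hk => hinj k hk.1 _ hx (hk.2.trans hvisit.symm)⟩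

theorem hasAlternatingPath (i : Fin φ.numVars) :
    φ.edgeColoring.toInstance.HasAlternatingPath φ.layer i := by
  intro c hc
  obtain ⟨col, hcol, hc_eq⟩ := φ.isSimple.exists_isColoring hc
  obtain ⟨f, hf⟩ := exists_eq_color_pick hcol
  obtain ⟨u, v, P, hP, hu, hv, hlayers, hedges⟩ := exists_isPath i.2 (f i)
  refine ⟨u, v, P, hP, hu, hv, hlayers, fun e => ?_, fun k hk => hc.getElem_edges_ne hP hk⟩
  obtain ⟨l, hl, he⟩ := (φ.isSimple.mem_edgeSet_iff e.1).1 e.2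
  rw [hedges, hc_eq e l hl he, eq_literalCode_iff hcol hf i hl]
  refine exists_congr fun τ => and_congr_right fun hτ => and_congr_right fun _ => ?_
  rw [he]
  exact ⟨φ.isSimple.ends_injOn l hl _ (inl_mem_labels.2 ⟨i.2, hτ⟩), fun h => h ▸ rfl⟩

end ThreeFourSAT

/-! ### Programs with polynomial running time -/

namespace RAM

namespace Prog

/-- The final state of a program without loops. -/
def run : Prog → State → State
  | skip, s => s
  | assign x e, s => ⟨Function.update s.reg x (e.eval s), s.arr, s.out⟩
  | store a e f, s =>
      ⟨s.reg, Function.update s.arr a (Function.update (s.arr a) (e.eval s) (f.eval s)), s.out⟩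
  | emit e, s => ⟨s.reg, s.arr, s.out ++ [e.eval s]⟩
  | seq p q, s => q.run (p.run s)
  | ite e p q, s => if e.eval s ≠ 0 then p.run s else q.run s
  | loop _ _, s => s

/-- A bound on the number of steps of a program without loops. -/
def time : Prog → ℕ
  | skip => 1
  | assign _ e => e.cost + 1
  | store _ e f => e.cost + f.cost + 1
  | emit e => e.cost + 1
  | seq p q => p.time + q.time
  | ite e p q => e.cost + 1 + (p.time + q.time)
  | loop _ _ => 0

/-- The program contains no loop, so that `run` and `time` describe its execution. -/
def LoopFree : Prog → Prop
  | seq p q => p.LoopFree ∧ q.LoopFree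
  | ite _ p q => p.LoopFree ∧ q.LoopFree
  | loop _ _ => False
  | _ => True

/-- The programs of a list, one after the other. -/
def block (ps : List Prog) : Prog :=
  ps.foldr seq skip

/-- The program that outputs the values of the given terms. -/
def emitAll (ts : List Term) : Prog :=
  block (ts.map emit)

theorem LoopFree.exists_exec {p : Prog} (hp : p.LoopFree) (s : State) :
    ∃ t ≤ p.time, Exec p s (p.run s) t := by
  induction p generalizing s with
  | skip => exact ⟨_, le_rfl, .skip s⟩
  | assign x e => exact ⟨_, le_rfl, .assign x e s⟩
  | store a e f => exact ⟨_, le_rfl, .store a e f s⟩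
  | emit e => exact ⟨_, le_rfl, .emit e s⟩
  | seq p q ihp ihq =>
    obtain ⟨t, ht, h⟩ := ihp hp.1 s
    obtain ⟨t', ht', h'⟩ := ihq hp.2 (p.run s)
    exact ⟨_, Nat.add_le_add ht ht', .seq h h'⟩
  | ite e p q ihp ihq =>
    by_cases he : e.eval s = 0
    · obtain ⟨t, ht, h⟩ := ihq hp.2 s
      refine ⟨e.cost + 1 + t, by simp only [time]; omega, ?_⟩
      simpa only [run, he, ne_eq, not_true_eq_false, if_false] using .ite_false he h
    · obtain ⟨t, ht, h⟩ := ihp hp.1 s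
      refine ⟨e.cost + 1 + t, by simp only [time]; omega, ?_⟩
      simpa only [run, he, ne_eq, not_false_eq_true, if_true] using .ite_true he h
  | loop e p => exact hp.elim

theorem loopFree_block {ps : List Prog} (h : ∀ p ∈ ps, p.LoopFree) : (block ps).LoopFree := by
  induction ps with
  | nil => trivial
  | cons p ps ih =>
    exact ⟨h p List.mem_cons_self, ih fun q hq => h q (List.mem_cons_of_mem _ hq)⟩

theorem loopFree_emitAll (ts : List Term) : (emitAll ts).LoopFree :=
  loopFree_block (List.forall_mem_map.2 fun _ _ => trivial)

end Prog

namespace Term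

/-- Multiplication by a constant, as repeated addition. -/
def smul : ℕ → Term → Term
  | 0, _ => const 0
  | k + 1, e => add (smul k e) e

theorem eval_smul (s : State) (k : ℕ) (e : Term) : (smul k e).eval s = k * e.eval s := by
  induction k with
  | zero => rw [smul, eval, Nat.zero_mul]
  | succ k ih => rw [smul, eval, ih, Nat.succ_mul]

theorem eval_congr {s s' : State} (hreg : s.reg = s'.reg) (harr : s.arr = s'.arr) (e : Term) :
    e.eval s = e.eval s' := by
  induction e <;> simp_all only [eval]

end Term

theorem Prog.run_emitAll (ts : List Term) (s : State) :
    (emitAll ts).run s = ⟨s.reg, s.arr, s.out ++ ts.map (Term.eval s)⟩ := by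
  induction ts generalizing s with
  | nil => rw [List.map_nil, List.append_nil]; rfl
  | cons e ts ih =>
    have hstep : (emitAll (e :: ts)).run s = (emitAll ts).run ((emit e).run s) := rfl
    have heval : Term.eval ((emit e).run s) = Term.eval s := funext (Term.eval_congr rfl rfl)
    rw [hstep, ih, heval]
    simp only [run, List.append_assoc, List.singleton_append, List.map_cons]

variable {ι : Type*} {size : ι → ℕ} {P Q R : ι → State → Prop} {p q : Prog}

/-- A Hoare triple with a time bound, for a family of pre- and postconditions: started in a state
with `P x`, the program halts in a state with `Q x` after a number of steps that is polynomial
in `size x`. -/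
def RunsInPolyTime (size : ι → ℕ) (P : ι → State → Prop) (p : Prog) (Q : ι → State → Prop) : Prop :=
  ∃ T : Polynomial ℕ, ∀ x s, P x s → ∃ s' t, Exec p s s' t ∧ t ≤ T.eval (size x) ∧ Q x s'

namespace RunsInPolyTime

theorem of_run (hp : p.LoopFree) (h : ∀ x s, P x s → Q x (p.run s)) :
    RunsInPolyTime size P p Q := by
  refine ⟨.C p.time, fun x s hs => ?_⟩
  obtain ⟨t, ht, hexec⟩ := hp.exists_exec s
  exact ⟨_, t, hexec, by rwa [Polynomial.eval_C], h x s hs⟩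

theorem seq (hp : RunsInPolyTime size P p Q) (hq : RunsInPolyTime size Q q R) :
    RunsInPolyTime size P (.seq p q) R := by
  obtain ⟨T, hp⟩ := hp
  obtain ⟨T', hq⟩ := hq
  refine ⟨T + T', fun x s hs => ?_⟩
  obtain ⟨s', t, hexec, ht, hs'⟩ := hp x s hs
  obtain ⟨s'', t', hexec', ht', hs''⟩ := hq x s' hs'
  exact ⟨s'', t + t', .seq hexec hexec', by rw [Polynomial.eval_add]; omega, hs''⟩

theorem imp (hp : RunsInPolyTime size P p Q) (h : ∀ x s, Q x s → R x s) :
    RunsInPolyTime size P p R := by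
  obtain ⟨T, hp⟩ := hp
  refine ⟨T, fun x s hs => ?_⟩
  obtain ⟨s', t, hexec, ht, hs'⟩ := hp x s hs
  exact ⟨s', t, hexec, ht, h x s' hs'⟩

theorem loop {e : Term} {m : ι → ℕ} {I : ι → ℕ → State → Prop} (M : Polynomial ℕ)
    (hm : ∀ x s, I x 0 s → m x ≤ M.eval (size x))
    (hcond : ∀ x s k, k ≤ m x → I x k s → (e.eval s ≠ 0 ↔ k < m x))
    (hbody : RunsInPolyTime (fun y : ι × ℕ => size y.1)
      (fun y s => y.2 < m y.1 ∧ I y.1 y.2 s) p fun y => I y.1 (y.2 + 1)) :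
    RunsInPolyTime size (fun x => I x 0) (.loop e p) fun x => I x (m x) := by
  obtain ⟨T, hbody⟩ := hbody
  have hrest : ∀ x j k s, k + j = m x → I x k s → ∃ s' t, Exec (.loop e p) s s' t ∧
      t ≤ j * (e.cost + 1 + T.eval (size x)) + (e.cost + 1) ∧ I x (m x) s' := by
    intro x j
    induction j with
    | zero =>
      intro k s hk hs
      have he : e.eval s = 0 := not_not.1 fun he => by have := (hcond x s k hk.le hs).1 he; omega
      exact ⟨s, _, .loop_done he, by omega, hk ▸ hs⟩
    | succ j ih =>
      intro k s hk hs
      have hlt : k < m x := by omega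
      obtain ⟨s', t, hexec, ht, hs'⟩ := hbody (x, k) s ⟨hlt, hs⟩
      obtain ⟨s'', t', hexec', ht', hs''⟩ := ih (k + 1) s' (by omega) hs'
      refine ⟨s'', _, .loop_step ((hcond x s k hlt.le hs).2 hlt) hexec hexec', ?_, hs''⟩
      simp only at ht
      rw [Nat.succ_mul]
      omega
  refine ⟨M * (.C (e.cost + 1) + T) + .C (e.cost + 1), fun x s hs => ?_⟩
  obtain ⟨s', t, hexec, ht, hs'⟩ := hrest x (m x) 0 s (Nat.zero_add _) hs
  refine ⟨s', t, hexec, ht.trans ?_, hs'⟩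
  simp only [Polynomial.eval_add, Polynomial.eval_mul, Polynomial.eval_C]
  gcongr
  exact hm x s hs

end RunsInPolyTime

end RAM

/-! ### The program for the reduction -/

theorem exists_fin_three {P : Fin 3 → Prop} : (∃ j, P j) ↔ P 0 ∨ P 1 ∨ P 2 := by
  simp [Fin.exists_fin_succ]

theorem add_one_div_and_mod {a b : ℕ} (hb : 0 < b) :
    (a % b + 1 < b → (a + 1) / b = a / b ∧ (a + 1) % b = a % b + 1) ∧
      (b ≤ a % b + 1 → (a + 1) / b = a / b + 1 ∧ (a + 1) % b = 0) := by
  have hdivmod := Nat.div_add_mod a b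
  have hmod := Nat.mod_lt a hb
  refine ⟨fun h => (Nat.div_mod_unique hb).2 ⟨by omega, h⟩,
    fun h => (Nat.div_mod_unique hb).2 ⟨by rw [Nat.mul_add]; omega, hb⟩⟩

namespace ThreeFourSAT

/-- The pairs of a port and an index that are taken by the literals of the first `k` clauses. -/
def taken (φ : ThreeFourSAT) (k : ℕ) : Set (ℕ × ℕ) :=
  {p | ∃ c < k, ∃ j, φ.port c j = p.1 ∧ φ.place c = p.2}

/-- The part of the output that describes the gadget of the variable `i`. -/
noncomputable def gadgetOutput (φ : ThreeFourSAT) (i : ℕ) : List ℕ :=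
  GadgetEdge.all.flatMap fun τ => φ.edgeColoring.entry (.inl (i, τ))

/-- The part of the output that describes the edges of the clause `c`. -/
noncomputable def clauseOutput (φ : ThreeFourSAT) (c : ℕ) : List ℕ :=
  (List.finRange 3).flatMap fun j => φ.edgeColoring.entry (.inr (c, j))

theorem encoding_edgeColoring (φ : ThreeFourSAT) :
    φ.edgeColoring.encoding = 378 * φ.side :: ((List.range φ.numVars).flatMap φ.gadgetOutput ++
      (List.range φ.clauses.length).flatMap φ.clauseOutput) := by
  simp only [LabelledInstance.encoding, edgeColoring, List.flatMap_append, List.flatMap_map,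
    SProd.sprod, List.product, List.flatMap_assoc]
  rfl

variable {φ : ThreeFourSAT} {k t : ℕ}

theorem lit_lt (hk : k < φ.clauses.length) (j : Fin 3) : φ.lit k j < 2 * φ.numVars := by
  have := var_lt hk j
  unfold var at this; omega

theorem taken_zero (φ : ThreeFourSAT) : φ.taken 0 = ∅ := by
  simp [taken]

theorem taken_succ (φ : ThreeFourSAT) (k : ℕ) :
    φ.taken (k + 1) = insert (φ.port k 2, φ.place k)
      (insert (φ.port k 1, φ.place k) (insert (φ.port k 0, φ.place k) (φ.taken k))) := by
  ext ⟨u, t⟩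
  simp only [taken, Set.mem_ofPred_eq, Set.mem_insert_iff, Prod.mk.injEq, Nat.lt_succ_iff_lt_or_eq,
    or_and_right, exists_or, exists_eq_left, exists_fin_three]
  grind

theorem occ_succ_eq_update (hk : k < φ.clauses.length) :
    φ.occ (k + 1) = Function.update (Function.update (Function.update (φ.occ k)
      (φ.var k 0) (φ.occ k (φ.var k 0) + 1)) (φ.var k 1) (φ.occ k (φ.var k 1) + 1))
      (φ.var k 2) (φ.occ k (φ.var k 2) + 1) := by
  funext x
  simp only [occ_succ, exists_fin_three, Function.update_apply]
  grind [(var_injective hk).ne (show (0 : Fin 3) ≠ 1 by decide),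
    (var_injective hk).ne (show (0 : Fin 3) ≠ 2 by decide),
    (var_injective hk).ne (show (1 : Fin 3) ≠ 2 by decide)]

theorem isFree_iff_forall_notMem_taken : φ.IsFree k t ↔ ∀ j, (φ.port k j, t) ∉ φ.taken k := by
  simp only [IsFree, SharesPort, taken, Set.mem_ofPred_eq]
  grind

end ThreeFourSAT

namespace RAM

open Term Prog

/-! Registers. The index `rIndex` is tried for the vertex of the clause `rClause`, and `rOffset` is
its product with the number of vertices. -/

abbrev rVars : ℕ := 0
abbrev rClauses : ℕ := 1
abbrev rSide : ℕ := 2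
abbrev rSquare : ℕ := 3
abbrev rVar : ℕ := 4
abbrev rQuot : ℕ := 5
abbrev rRem : ℕ := 6
abbrev rClause : ℕ := 7
abbrev rIndex : ℕ := 8
abbrev rOffset : ℕ := 9
abbrev rLit (j : Fin 3) : ℕ := 10 + j
abbrev rPort (j : Fin 3) : ℕ := 13 + j

/-! Arrays. Since there is no multiplication and no division, `aVar` holds the variable of each
literal, and `aPort` and `aColor` hold, for each variable, the port of its next occurrence as a
first literal and the part of the color there that is a multiple of the number of variables. A used
pair of a port and an index is marked in `aUsed`. -/

abbrev aInput : ℕ := 0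
abbrev aVar : ℕ := 1
abbrev aPort : ℕ := 2
abbrev aColor : ℕ := 3
abbrev aUsed : ℕ := 4

def readSizes : Prog :=
  block [assign rVars (read aInput (const 0)), assign rClauses (read aInput (const 1))]

def sideBody : Prog :=
  block [assign rSquare (add (add (reg rSquare) (smul 2 (reg rSide))) (const 1)),
    assign rSide (add (reg rSide) (const 1))]

def computeSide : Prog :=
  loop (sub (add (reg rVars) (const 1)) (reg rSquare)) sideBody

def emitNumVertices : Prog :=
  emit (smul 378 (reg rSide))

def layerIndexTerm (k : ℕ) : Term :=
  if k % 3 = 0 then reg rQuot else if k % 3 = 1 then reg rRem else add (reg rQuot) (reg rRem)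

def vertexTerm (k : ℕ) : Term :=
  add (smul 63 (layerIndexTerm k)) (const k)

def colorTerm (p : ℕ × ℕ) : Term :=
  add (add (smul 2 (reg rVar)) (const p.1)) (smul (2 * p.2) (reg rVars))

def gadgetTerms (τ : GadgetEdge) : List Term :=
  [vertexTerm τ.lo, vertexTerm τ.hi, const 2, colorTerm τ.ifTrue, colorTerm τ.ifFalse]

def initTables : Prog :=
  block [store aVar (smul 2 (reg rVar)) (reg rVar),
    store aVar (add (smul 2 (reg rVar)) (const 1)) (reg rVar),
    store aPort (reg rVar) (smul 63 (reg rQuot)), store aColor (reg rVar) (smul 2 (reg rVars))]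

def nextVar : Prog :=
  block [assign rVar (add (reg rVar) (const 1)), assign rRem (add (reg rRem) (const 1)),
    ite (sub (reg rSide) (reg rRem)) skip
      (block [assign rRem (const 0), assign rQuot (add (reg rQuot) (const 1))])]

def varBody : Prog :=
  seq (emitAll (GadgetEdge.all.flatMap gadgetTerms)) (seq initTables nextVar)

def emitGadgets : Prog :=
  loop (sub (reg rVars) (reg rVar)) varBody

def loadLiteral (j : Fin 3) : Prog :=
  block [assign (rLit j) (read aInput (add (smul 3 (reg rClause)) (const (2 + j)))),
    assign (rPort j) (add (read aPort (read aVar (reg (rLit j)))) (const (3 * j)))]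

def loadClause : Prog :=
  block [loadLiteral 0, loadLiteral 1, loadLiteral 2, assign rIndex (const 0),
    assign rOffset (const 0)]

def usedTerm (j : Fin 3) : Term :=
  read aUsed (add (reg (rPort j)) (reg rOffset))

def searchCond : Term :=
  add (add (usedTerm 0) (usedTerm 1)) (usedTerm 2)

def nextIndex : Prog :=
  block [assign rIndex (add (reg rIndex) (const 1)),
    assign rOffset (add (reg rOffset) (smul 378 (reg rSide)))]

def literalTerms (j : Fin 3) : List Term :=
  [reg (rPort j), add (smul 63 (add (smul 2 (reg rSide)) (reg rIndex))) (const 1), const 3,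
    add (reg (rLit j)) (add (read aColor (read aVar (reg (rLit j)))) (smul (2 * j) (reg rVars))),
    add (smul 42 (reg rVars)) (smul 2 (reg rClause)),
    add (add (smul 42 (reg rVars)) (smul 2 (reg rClause))) (const 1)]

def emitClause : Prog :=
  emitAll ((List.finRange 3).flatMap literalTerms)

def mark (j : Fin 3) : Prog :=
  block [store aUsed (add (reg (rPort j)) (reg rOffset)) (const 1),
    store aPort (read aVar (reg (rLit j))) (add (read aPort (read aVar (reg (rLit j)))) (const 9)),
    store aColor (read aVar (reg (rLit j)))
      (add (read aColor (read aVar (reg (rLit j)))) (smul 6 (reg rVars)))]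

def markClause : Prog :=
  block [mark 0, mark 1, mark 2, assign rClause (add (reg rClause) (const 1))]

def clauseBody : Prog :=
  seq loadClause (seq (loop searchCond nextIndex) (seq emitClause markClause))

def emitClauses : Prog :=
  loop (sub (reg rClauses) (reg rClause)) clauseBody

/-- The program for the reduction. -/
def reduction : Prog :=
  seq readSizes (seq computeSide (seq emitNumVertices (seq emitGadgets emitClauses)))

/-- The registers that stay unchanged once the side is known. -/
structure Sizes (φ : ThreeFourSAT) (r : ℕ → ℕ) : Prop where
  vars : r rVars = φ.numVars
  clauses : r rClauses = φ.clauses.length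
  side : r rSide = φ.side

/-- The arrays hold the values for the variables below `i`, when each variable `x` has occurred
`o x` times and the pairs in `U` are used. -/
structure Tables (φ : ThreeFourSAT) (i : ℕ) (o : ℕ → ℕ) (U : Set (ℕ × ℕ)) (a : ℕ → ℕ → ℕ) :
    Prop where
  input : a aInput = fun x => φ.word.getD x 0
  variable_eq : ∀ x < 2 * i, a aVar x = x / 2
  port : ∀ x < i, a aPort x = 63 * (x / φ.side) + 9 * o x
  color : ∀ x < i, a aColor x = 2 * φ.numVars + 6 * φ.numVars * o x
  used : ∀ u < 378 * φ.side, ∀ t, a aUsed (u + 378 * φ.side * t) ≠ 0 ↔ (u, t) ∈ U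

/-- The state when `k * k` has been computed. -/
structure SideInv (φ : ThreeFourSAT) (k : ℕ) (s : State) : Prop where
  vars : s.reg rVars = φ.numVars
  clauses : s.reg rClauses = φ.clauses.length
  side : s.reg rSide = k
  square : s.reg rSquare = k * k
  var : s.reg rVar = 0
  quot : s.reg rQuot = 0
  rem : s.reg rRem = 0
  clause : s.reg rClause = 0
  input : s.arr aInput = fun x => φ.word.getD x 0
  used : s.arr aUsed = 0
  out : s.out = []

/-- The state after the gadgets of the first `k` variables. -/
structure VarInv (φ : ThreeFourSAT) (k : ℕ) (s : State) : Prop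
    extends Sizes φ s.reg, Tables φ k 0 ∅ s.arr where
  var : s.reg rVar = k
  quot : s.reg rQuot = k / φ.side
  rem : s.reg rRem = k % φ.side
  clause : s.reg rClause = 0
  out : s.out = 378 * φ.side :: (List.range k).flatMap φ.gadgetOutput

/-- The state after the first `k` clauses. -/
structure ClauseInv (φ : ThreeFourSAT) (k : ℕ) (s : State) : Prop
    extends Sizes φ s.reg, Tables φ φ.numVars (φ.occ k) (φ.taken k) s.arr where
  clause : s.reg rClause = k
  out : s.out = 378 * φ.side :: ((List.range φ.numVars).flatMap φ.gadgetOutput ++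
    (List.range k).flatMap φ.clauseOutput)

/-- The state when the index `t` is tried for the clause `k`. -/
structure SearchInv (φ : ThreeFourSAT) (k t : ℕ) (s : State) : Prop extends ClauseInv φ k s where
  clause_lt : k < φ.clauses.length
  lit_reg : ∀ j, s.reg (rLit j) = φ.lit k j
  port_reg : ∀ j, s.reg (rPort j) = φ.port k j
  index : s.reg rIndex = t
  offset : s.reg rOffset = 378 * φ.side * t

variable {φ : ThreeFourSAT} {k t : ℕ} {s : State}

/-! #### The side -/

theorem sideInv_readSizes (φ : ThreeFourSAT) : SideInv φ 0 (readSizes.run (start φ.word)) := by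
  constructor <;> rfl

theorem SideInv.sideBody (h : SideInv φ k s) : SideInv φ (k + 1) (sideBody.run s) := by
  constructor
  all_goals
    simp +decide only [RAM.sideBody, block, List.foldr, run, eval, eval_smul,
      Function.update_of_ne, Function.update_self, ne_eq, h.vars, h.clauses, h.side, h.square,
      h.var, h.quot, h.rem, h.clause, h.input, h.used, h.out]
  ring

theorem runsInPolyTime_computeSide :
    RunsInPolyTime ThreeFourSAT.numVars (SideInv · 0) computeSide fun φ => SideInv φ φ.side := by
  refine .loop (.X + .C 1) (fun φ _ _ => ?_) (fun φ s k _ hs => ?_)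
    (.of_run (by simp [sideBody, block, LoopFree]) fun _ _ hs => hs.2.sideBody)
  · simpa using φ.side_le
  · rw [φ.lt_side_iff]
    simp only [eval, hs.vars, hs.square]
    omega

/-! #### The gadgets of the variables -/

theorem SideInv.emitNumVertices (h : SideInv φ φ.side s) : VarInv φ 0 (emitNumVertices.run s) where
  vars := h.vars
  clauses := h.clauses
  side := h.side
  input := h.input
  variable_eq x hx := absurd hx x.not_lt_zero
  port x hx := absurd hx x.not_lt_zero
  color x hx := absurd hx x.not_lt_zero
  used u _ t := by simp [RAM.emitNumVertices, run, h.used]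
  var := h.var
  quot := h.quot.trans (Nat.zero_div _).symm
  rem := h.rem.trans (Nat.zero_mod _).symm
  clause := h.clause
  out := by simp [RAM.emitNumVertices, run, eval_smul, eval, h.side, h.out]

theorem VarInv.eval_gadgetTerms (h : VarInv φ k s) :
    (GadgetEdge.all.flatMap gadgetTerms).map (eval s) = φ.gadgetOutput k := by
  have hvertex : ∀ l, (vertexTerm l).eval s = φ.vertex k l := fun l => by
    simp only [vertexTerm, layerIndexTerm, ThreeFourSAT.vertex, ThreeFourSAT.layerIndex]
    split_ifs <;> simp only [eval, eval_smul, h.quot, h.rem]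
  have hcolor : ∀ p, (colorTerm p).eval s = φ.color k p := fun p => by
    simp only [colorTerm, ThreeFourSAT.color, eval, eval_smul, h.var, h.vars]
    ring
  simp only [List.map_flatMap, gadgetTerms, List.map_cons, List.map_nil, hvertex, hcolor, eval]
  rfl

theorem Tables.initTables (h : Tables φ k 0 ∅ s.arr) (hvars : s.reg rVars = φ.numVars)
    (hvar : s.reg rVar = k) (hquot : s.reg rQuot = k / φ.side) :
    Tables φ (k + 1) 0 ∅ (initTables.run s).arr := by
  constructor
  all_goals
    simp +decide only [RAM.initTables, block, List.foldr, run, eval, eval_smul,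
      Function.update_of_ne, Function.update_self, ne_eq, hvars, hvar, hquot]
  case input => exact h.input
  case used => exact h.used
  all_goals
    intro x hx
    simp only [Function.update_apply]
    split_ifs
  · omega
  · omega
  · exact h.variable_eq x (by omega)
  · subst x; rfl
  · exact h.port x (by omega)
  · rfl
  · exact h.color x (by omega)

theorem run_nextVar (hside : s.reg rSide = φ.side) (hquot : s.reg rQuot = k / φ.side)
    (hrem : s.reg rRem = k % φ.side) :
    nextVar.run s = ⟨Function.update (Function.update (Function.update s.reg rVar (s.reg rVar + 1))
      rRem ((k + 1) % φ.side)) rQuot ((k + 1) / φ.side), s.arr, s.out⟩ := by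
  obtain ⟨hstay, hcarry⟩ := add_one_div_and_mod (a := k) φ.side_pos
  simp +decide only [nextVar, block, List.foldr, run, eval, Function.update_of_ne,
    Function.update_self, ne_eq, hside, hquot, hrem]
  rcases Nat.lt_or_ge (k % φ.side + 1) φ.side with hlt | hge
  · rw [if_pos (by omega), (hstay hlt).1, (hstay hlt).2]
    congr 1
    refine (Function.update_eq_self_iff.2 ?_).symm
    simp +decide only [Function.update_of_ne, ne_eq, hquot]
  · rw [if_neg (by omega), (hcarry hge).1, (hcarry hge).2, Function.update_idem]

theorem VarInv.varBody (h : VarInv φ k s) : VarInv φ (k + 1) (varBody.run s) := by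
  have htables : Tables φ (k + 1) 0 ∅ (initTables.run s).arr :=
    h.toTables.initTables h.vars h.var h.quot
  let s' : State := ⟨s.reg, s.arr, s.out ++ φ.gadgetOutput k⟩
  have hrun : RAM.varBody.run s = nextVar.run (RAM.initTables.run s') := by
    simp only [RAM.varBody, run, run_emitAll, h.eval_gadgetTerms, s']
  rw [hrun, run_nextVar (s := RAM.initTables.run s') h.side h.quot h.rem]
  refine ⟨⟨?_, ?_, ?_⟩, htables, ?_, ?_, ?_, ?_, ?_⟩
  all_goals
    simp +decide only [RAM.initTables, block, List.foldr, run, Function.update_of_ne,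
      Function.update_self, ne_eq, s', h.vars, h.clauses, h.side, h.var, h.clause]
  rw [h.out, List.range_succ, List.flatMap_append, List.flatMap_singleton, List.cons_append]

theorem runsInPolyTime_emitGadgets :
    RunsInPolyTime ThreeFourSAT.numVars (VarInv · 0) emitGadgets fun φ => VarInv φ φ.numVars := by
  refine .loop .X (fun φ _ _ => ?_) (fun φ s k _ hs => ?_) (.of_run ?_ fun _ _ hs => hs.2.varBody)
  · rw [Polynomial.eval_X]
  · simp only [eval, hs.vars, hs.var]
    omega
  · exact ⟨loopFree_emitAll _, by simp [initTables, block, LoopFree],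
      by simp [nextVar, block, LoopFree]⟩

end RAM

namespace RAM

open Term Prog
open ThreeFourSAT (lit_lt var_lt port_lt port_eq litColor_eq isFree_iff_forall_notMem_taken
  place_le not_isFree_of_lt_place isFree_place var_injective occ_succ_eq_update taken_succ)

variable {φ : ThreeFourSAT} {k t : ℕ} {s : State} {o : ℕ → ℕ} {U : Set (ℕ × ℕ)}

/-! #### The edges of the clauses -/

theorem VarInv.clauseInv (h : VarInv φ φ.numVars s) : ClauseInv φ 0 s where
  vars := h.vars
  clauses := h.clauses
  side := h.side
  input := h.input
  variable_eq := h.variable_eq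
  port := h.port
  color := h.color
  used := φ.taken_zero ▸ h.used
  clause := h.clause
  out := by rw [h.out, List.range_zero, List.flatMap_nil, List.append_nil]

theorem ClauseInv.update_reg (h : ClauseInv φ k s) {x : ℕ} (hx : rClause < x) (v : ℕ) :
    ClauseInv φ k ⟨Function.update s.reg x v, s.arr, s.out⟩ := by
  have hreg : ∀ y ≤ rClause, Function.update s.reg x v y = s.reg y := fun y hy =>
    Function.update_of_ne (hy.trans_lt hx).ne _ _
  exact ⟨⟨(hreg _ (by decide)).trans h.vars, (hreg _ (by decide)).trans h.clauses,
    (hreg _ (by decide)).trans h.side⟩, h.toTables, (hreg _ le_rfl).trans h.clause, h.out⟩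

theorem ClauseInv.run_loadLiteral (h : ClauseInv φ k s) (hk : k < φ.clauses.length) (j : Fin 3) :
    (loadLiteral j).run s = ⟨Function.update (Function.update s.reg (rLit j) (φ.lit k j)) (rPort j)
      (φ.port k j), s.arr, s.out⟩ := by
  have hlit : s.arr aInput (3 * k + (2 + j)) = φ.lit k j := by
    rw [h.input, ThreeFourSAT.lit, Nat.add_assoc]
  have hport : s.arr aPort (s.arr aVar (φ.lit k j)) + 3 * j = φ.port k j := by
    rw [h.variable_eq _ (lit_lt hk j), ← ThreeFourSAT.var,
      h.port _ (var_lt hk j), port_eq, ThreeFourSAT.slot]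
    ring
  simp only [loadLiteral, block, List.foldr, run, eval, eval_smul, h.clause, hlit,
    Function.update_self, hport]

theorem ClauseInv.loadClause (h : ClauseInv φ k s) (hk : k < φ.clauses.length) :
    SearchInv φ k 0 (loadClause.run s) := by
  have hload : ∀ {s : State}, ClauseInv φ k s → ∀ j, ClauseInv φ k ((loadLiteral j).run s) :=
    fun h j => by
      rw [h.run_loadLiteral hk]
      exact (h.update_reg (Nat.lt_add_right _ (by decide)) _).update_reg
        (Nat.lt_add_right _ (by decide)) _
  have h₁ := hload h 0
  have h₂ := hload h₁ 1
  have h₃ := hload h₂ 2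
  refine ⟨(h₃.update_reg (x := rIndex) (by decide) 0).update_reg (x := rOffset) (by decide) 0,
    hk, fun j => ?_, fun j => ?_, ?_, ?_⟩
  all_goals
    simp only [RAM.loadClause, block, List.foldr, run]
    rw [h₂.run_loadLiteral hk, h₁.run_loadLiteral hk, h.run_loadLiteral hk]
    try fin_cases j
  all_goals
    simp +decide only [Function.update_of_ne, Function.update_self, ne_eq, eval,
      Fin.zero_eta, Fin.mk_one, Fin.reduceFinMk, Nat.mul_zero]

theorem SearchInv.eval_searchCond_ne_zero_iff (h : SearchInv φ k t s) :
    searchCond.eval s ≠ 0 ↔ ¬ φ.IsFree k t := by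
  have hused : ∀ j, (usedTerm j).eval s ≠ 0 ↔ (φ.port k j, t) ∈ φ.taken k := fun j => by
    have := port_lt h.clause_lt j
    rw [← h.used _ (by omega) t]
    simp only [usedTerm, eval, h.port_reg, h.offset]
  rw [isFree_iff_forall_notMem_taken, not_forall_not, exists_fin_three,
    ← hused, ← hused, ← hused]
  simp only [searchCond, eval]
  omega

theorem SearchInv.nextIndex (h : SearchInv φ k t s) : SearchInv φ k (t + 1) (nextIndex.run s) := by
  refine ⟨(h.update_reg (x := rIndex) (by decide) _).update_reg (x := rOffset) (by decide) _,
    h.clause_lt, fun j => ?_, fun j => ?_, ?_, ?_⟩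
  all_goals
    simp only [RAM.nextIndex, block, List.foldr, run, eval, eval_smul]
    try fin_cases j
  all_goals
    simp +decide only [Function.update_of_ne, Function.update_self, ne_eq,
      h.lit_reg, h.port_reg, h.index, h.offset, h.side]
  ring

theorem runsInPolyTime_searchIndex :
    RunsInPolyTime (fun y : ThreeFourSAT × ℕ => y.1.numVars) (fun y => SearchInv y.1 y.2 0)
      (loop searchCond nextIndex) fun y => SearchInv y.1 y.2 (y.1.place y.2) := by
  refine .loop (m := fun y : ThreeFourSAT × ℕ => y.1.place y.2)
    (I := fun y => SearchInv y.1 y.2) (.C 3 * (.X + .C 1)) (fun y s hs => ?_)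
    (fun y s t ht hs => ?_)
    (.of_run (by simp [nextIndex, block, LoopFree]) fun _ _ hs => hs.2.nextIndex)
  · simpa using (place_le hs.clause_lt).trans (Nat.mul_le_mul_left 3 y.1.side_le)
  · rw [hs.eval_searchCond_ne_zero_iff]
    refine ⟨fun h => ht.lt_of_ne ?_, not_isFree_of_lt_place⟩
    rintro rfl
    exact h (isFree_place hs.clause_lt)

theorem SearchInv.eval_literalTerms (h : SearchInv φ k (φ.place k) s) :
    ((List.finRange 3).flatMap literalTerms).map (eval s) = φ.clauseOutput k := by
  have hcolor (j : Fin 3) : φ.lit k j + (s.arr aColor (s.arr aVar (φ.lit k j)) +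
      2 * j * φ.numVars) = φ.litColor k j := by
    rw [h.variable_eq _ (lit_lt h.clause_lt j), ← ThreeFourSAT.var,
      h.color _ (var_lt h.clause_lt j), litColor_eq, ThreeFourSAT.slot]
    ring
  simp only [List.map_flatMap, literalTerms, List.map_cons, List.map_nil, eval, eval_smul,
    h.lit_reg, h.port_reg, h.index, h.side, h.vars, h.clause, hcolor]
  rfl

theorem SearchInv.run_emitClause (h : SearchInv φ k (φ.place k) s) :
    emitClause.run s = ⟨s.reg, s.arr, s.out ++ φ.clauseOutput k⟩ := by
  rw [RAM.emitClause, run_emitAll, h.eval_literalTerms]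

theorem Tables.mark {j : Fin 3} (h : Tables φ φ.numVars o U s.arr) (hk : k < φ.clauses.length)
    (hvars : s.reg rVars = φ.numVars) (hlit : s.reg (rLit j) = φ.lit k j)
    (hport : s.reg (rPort j) = φ.port k j) (hoffset : s.reg rOffset = 378 * φ.side * t) :
    Tables φ φ.numVars (Function.update o (φ.var k j) (o (φ.var k j) + 1))
      (insert (φ.port k j, t) U) ((mark j).run s).arr := by
  have hvar : s.arr aVar (φ.lit k j) = φ.var k j :=
    h.variable_eq _ (lit_lt hk j)
  have hport_lt := port_lt hk j
  constructor
  all_goals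
    simp +decide only [RAM.mark, block, List.foldr, run, eval, eval_smul,
      Function.update_of_ne, Function.update_self, ne_eq, hvars, hlit, hport, hoffset, hvar]
  case input => exact h.input
  case variable_eq => exact h.variable_eq
  case used =>
    intro u hu t'
    simp only [Function.update_apply, add_mul_eq_add_mul_iff hu (by omega : φ.port k j < _),
      Set.mem_insert_iff, Prod.mk.injEq, ← h.used u hu t']
    split_ifs with heq <;> simp [heq]
  all_goals
    intro x hx
    simp only [Function.update_apply, h.port _ (var_lt hk j),
      h.color _ (var_lt hk j)]
    split_ifs with heq
  · subst x; ring
  · exact h.port x hx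
  · subst x; ring
  · exact h.color x hx

theorem SearchInv.markClause (h : SearchInv φ k (φ.place k) s) :
    ClauseInv φ (k + 1) (markClause.run ⟨s.reg, s.arr, s.out ++ φ.clauseOutput k⟩) := by
  have hmark (j : Fin 3) {o U} {s' : State} (htables : Tables φ φ.numVars o U s'.arr)
      (hreg : s'.reg = s.reg) :=
    htables.mark h.clause_lt (hreg ▸ h.vars) (hreg ▸ h.lit_reg j) (hreg ▸ h.port_reg j)
      (hreg ▸ h.offset)
  have h₁ := hmark 0 (s' := ⟨s.reg, s.arr, s.out ++ φ.clauseOutput k⟩) h.toTables rfl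
  have h₂ := hmark 1 h₁ rfl
  have h₃ := hmark 2 h₂ rfl
  have hne : ∀ j j', j ≠ j' → φ.var k j ≠ φ.var k j' := fun _ _ =>
    (var_injective h.clause_lt).ne
  simp +decide only [Function.update_of_ne, hne, ne_eq] at h₃
  rw [← occ_succ_eq_update h.clause_lt, ← taken_succ] at h₃
  refine ⟨⟨h.vars, h.clauses, h.side⟩, h₃, congrArg (· + 1) h.clause, ?_⟩
  simp only [RAM.markClause, RAM.mark, block, List.foldr, run, h.out, List.range_succ,
    List.flatMap_append, List.flatMap_singleton, List.cons_append, List.append_assoc]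

theorem runsInPolyTime_clauseBody :
    RunsInPolyTime (fun y : ThreeFourSAT × ℕ => y.1.numVars)
      (fun y s => y.2 < y.1.clauses.length ∧ ClauseInv y.1 y.2 s) clauseBody
      fun y => ClauseInv y.1 (y.2 + 1) := by
  have hload : RunsInPolyTime (fun y : ThreeFourSAT × ℕ => y.1.numVars)
      (fun y s => y.2 < y.1.clauses.length ∧ ClauseInv y.1 y.2 s) loadClause
      fun y => SearchInv y.1 y.2 0 :=
    .of_run (by simp [loadClause, loadLiteral, block, LoopFree]) fun _ _ hs =>
      hs.2.loadClause hs.1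
  have hmark : RunsInPolyTime (fun y : ThreeFourSAT × ℕ => y.1.numVars)
      (fun y => SearchInv y.1 y.2 (y.1.place y.2)) (seq emitClause markClause)
      fun y => ClauseInv y.1 (y.2 + 1) :=
    .of_run ⟨loopFree_emitAll _, by simp [markClause, mark, block, LoopFree]⟩ fun _ _ hs => by
      rw [run, hs.run_emitClause]
      exact hs.markClause
  exact hload.seq (runsInPolyTime_searchIndex.seq hmark)

theorem runsInPolyTime_emitClauses :
    RunsInPolyTime ThreeFourSAT.numVars (ClauseInv · 0) emitClauses
      fun φ => ClauseInv φ φ.clauses.length := by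
  refine .loop (.C 4 * .X) (fun φ _ _ => ?_) (fun φ s k _ hs => ?_) runsInPolyTime_clauseBody
  · simpa using φ.length_clauses_le
  · simp only [eval, hs.clauses, hs.clause]
    omega

theorem runsInPolyTime_reduction :
    RunsInPolyTime ThreeFourSAT.numVars (fun φ s => s = start φ.word) reduction
      fun φ s => s.out = φ.edgeColoring.encoding := by
  have hread : RunsInPolyTime ThreeFourSAT.numVars (fun φ s => s = start φ.word) readSizes
      (SideInv · 0) :=
    .of_run (by simp [readSizes, block, LoopFree]) fun φ _ hs => hs ▸ sideInv_readSizes φ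
  have hemit : RunsInPolyTime ThreeFourSAT.numVars (fun φ => SideInv φ φ.side) emitNumVertices
      (VarInv · 0) :=
    .of_run trivial fun _ _ hs => hs.emitNumVertices
  refine (hread.seq (runsInPolyTime_computeSide.seq (hemit.seq
    ((runsInPolyTime_emitGadgets.imp fun _ _ hs => hs.clauseInv).seq
      runsInPolyTime_emitClauses)))).imp fun φ s hs => ?_
  rw [hs.out, ThreeFourSAT.encoding_edgeColoring]

end RAM

theorem lemma4 :
    ∃ f : ThreeFourSAT → ListEdgeColoringInstance,
      ComputableInPolynomialTime f ∧
      (∀ φ : ThreeFourSAT, φ.Satisfiable ↔ (f φ).Colorable) ∧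
      (∃ K : ℝ, ∀ φ : ThreeFourSAT, 1 ≤ φ.numVars →
        ((f φ).numVertices : ℝ) ≤ K * Real.sqrt φ.numVars) ∧
      ∀ φ : ThreeFourSAT, ∃ layer : Fin (f φ).numVertices → Fin 63,
        (∀ u v, (f φ).graph.Adj u v → layer u ≠ layer v) ∧
        ∀ i : Fin φ.numVars, (f φ).HasAlternatingPath layer i := by
  refine ⟨fun φ => φ.edgeColoring.toInstance, ?_, fun φ => φ.satisfiable_iff_colorable,
    ⟨756, fun φ hφ => ?_⟩,
    fun φ => ⟨φ.layer, fun _ _ => φ.layer_ne_of_adj, φ.hasAlternatingPath⟩⟩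
  · obtain ⟨T, hT⟩ := RAM.runsInPolyTime_reduction
    refine ⟨RAM.reduction, T, fun φ => ?_⟩
    obtain ⟨s, t, hexec, ht, hs⟩ := hT φ _ rfl
    exact ⟨s, t, hexec, ht, hs ▸ φ.isSimple.isDescribedBy_encoding⟩
  · have hvertices : φ.edgeColoring.toInstance.numVertices = 378 * φ.side := rfl
    rw [hvertices, Nat.cast_mul, Nat.cast_ofNat]
    linarith [φ.side_le_two_mul_sqrt hφ]
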